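/- Let $\mathbf x=(x_n)_{n\ge 0}$ be a real sequence. For $k\ge 1$ and open intervals $I_0,\dots,I_{k-1}\subseteq\mathbb R$ (bounded or unbounded), $\mathbf I=I_0\times\dots\times I_{k-1}$, let $S_k^{\mathbf I}(\mathbf x)=\{n\ge 0: x_n\in I_0,\dots,x_{n+k-1}\in I_{k-1}\}$ and $N_k^{\mathbf I}(n)=|S_k^{\mathbf I}(\mathbf x)\cap[0,n-1]|$. Let $A_1$ be the set of all $\mathbf x$ such that (E) for all $k$ and $\mathbf I$, either $S_k^{\mathbf I}(\mathbf x)=\emptyset$ or $\lim_{n}N_k^{\mathbf I}(n)/n$ exists and is positive; and (T) $\lim_{K\to\infty}\lim_{n\to\infty}\frac1n|\{0\le i<n:|x_i|<K\}|=1$. A sequence $\mathbf x$ *induces* the process $\mathbf Y$ (a probability law on $\mathbb R^{\mathbb N_0}$) if, for every $k$, the empirical measures $F_n^k=\frac1n\sum_{i=0}^{n-1}\delta_{(x_i,\dots,x_{i+k-1})}$ converge weakly to the law of $(Y_0,\dots,Y_{k-1})$ as $n\to\infty$. Let $A$ be the set of $\mathbf x\in A_1$ that induce a stationary process $\mathbf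 Y^{\mathbf x}$ which is ergodic. An *asymptotically proportional contraction* of $\mathbf x$ is a subsequence $\mathbf x'=(x_n)_{n\in G}$, enumerated increasingly, where $G=\bigcup_{i\ge1}G_i\subseteq\mathbb N_0$, the $G_i$ are nonempty finite sets of consecutive integers with $\max G_i<\min G_{i+1}$, $|G_i|\to\infty$, and $|G\cap[0,n-1]|/n\to c$ for some $c>0$. Write $N'$ for the counting functions of $\mathbf x'$. **Theorem.** Let $\mathbf x\in A_1$. 1. $\mathbf x\in A$ if and only if every asymptotically proportional contraction of $\mathbf x$ induces the same process as $\mathbf x$. 2. If for every asymptotically proportional contraction $\mathbf x'$ of $\mathbf x$ and all $k$ and $\mathbf I$ both limits exist and $$\lim_{n\to\infty}\frac{{N'}_k^{\mathbf I}(n)}{n}=\lim_{n\to\infty}\frac{N_k^{\mathbf I}(n)}{n},\qquad(*)$$ then $\mathbf x\in A$. 3. Conversely, if $\mathbf x\in A$, and if there is a process $\mathbf Y$ with $\lim_n N_k^{\mathbf I}(n)/n=P(Y_0\in I_0,\dots,Y_{k-1}\in I_{k-1})$ for all $k$ and $\mathbf I$, then for every asymptotically proportional contraction $\mathbf x'$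 and all $k$ and $\mathbf I$ both limits in $(*)$ exist and $(*)$ holds. -/

import Mathlib

open MeasureTheory Filter Topology

noncomputable section

/-- An open interval of the real line, bounded or not. -/
def IsOpenInterval (I : Set ℝ) : Prop :=
  ∃ a b : EReal, I = {t : ℝ | a < (t : EReal) ∧ (t : EReal) < b}

/-- `S ⊆ ℕ` has density `d`: `|S ∩ [0, n - 1]| / n → d`. -/
def HasDensity (S : Set ℕ) (d : ℝ) : Prop :=
  Tendsto (fun n : ℕ => ((S ∩ Set.Iio n).ncard : ℝ) / n) atTop (𝓝 d)

/-- `{n ≥ 0 : x_n ∈ I_0, …, x_{n+k-1} ∈ I_{k-1}}`. -/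
def hitSet (x : ℕ → ℝ) {k : ℕ} (I : Fin k → Set ℝ) : Set ℕ :=
  {n | ∀ j : Fin k, x (n + j) ∈ I j}

/-- Property E for all `k` and all products of `k` open intervals: the set of occurrences is empty
or has a positive density (for `k = 0` this holds trivially). -/
def PropertyE (x : ℕ → ℝ) : Prop :=
  ∀ (k : ℕ) (I : Fin k → Set ℝ), (∀ j, IsOpenInterval (I j)) →
    hitSet x I = ∅ ∨ ∃ d : ℝ, 0 < d ∧ HasDensity (hitSet x I) d

/-- Property T: `lim_{K → ∞} lim_{n → ∞} |{i < n : |x_i| < K}| / n = 1`, the limits existing. -/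
def PropertyT (x : ℕ → ℝ) : Prop :=
  ∃ d : ℝ → ℝ, (∀ K : ℝ, HasDensity {i | |x i| < K} (d K)) ∧ Tendsto d atTop (𝓝 1)

/-- The set `A_1`. -/
def pathsA1 : Set (ℕ → ℝ) := {x | PropertyE x ∧ PropertyT x}

/-- The `k`-dimensional empirical measure of `x` built from the `n + 1` windows
`(x_i, …, x_{i+k-1})`, `0 ≤ i ≤ n`. -/
def empiricalLaw (x : ℕ → ℝ) (k n : ℕ) : ProbabilityMeasure (Fin k → ℝ) :=
  ⟨((n + 1 : ℕ) : ENNReal)⁻¹ •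
      ∑ i ∈ Finset.range (n + 1), Measure.dirac (fun j : Fin k => x (i + j)), by
    constructor
    simp only [Measure.smul_apply, Measure.finsetSum_apply, measure_univ, Finset.sum_const,
      Finset.card_range, smul_eq_mul, nsmul_eq_mul, mul_one]
    exact ENNReal.inv_mul_cancel (by simp) (ENNReal.natCast_ne_top _)⟩

/-- The law of the first `k` coordinates of a process with law `μ`. -/
def finDimLaw (μ : ProbabilityMeasure (ℕ → ℝ)) (k : ℕ) : ProbabilityMeasure (Fin k → ℝ) :=
  μ.map (f := fun (y : ℕ → ℝ) (j : Fin k) => y j)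
    (by fun_prop : Measurable fun (y : ℕ → ℝ) (j : Fin k) => y j).aemeasurable

/-- `x` induces the process with law `μ` on the path space: for every `k` the `k`-dimensional
empirical measures of `x` converge (weakly) to the `k`-dimensional distribution of `μ`.
Such a `μ` is unique, and it is automatically shift-invariant. -/
def Induces (x : ℕ → ℝ) (μ : ProbabilityMeasure (ℕ → ℝ)) : Prop :=
  ∀ k : ℕ, Tendsto (fun n => empiricalLaw x k n) atTop (𝓝 (finDimLaw μ k))

/-- The two sequences induce processes, and these have the same law. -/
def InduceSameProcess (x x' : ℕ → ℝ) : Prop :=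
  ∃ μ : ProbabilityMeasure (ℕ → ℝ), Induces x μ ∧ Induces x' μ

/-- The shift on the path space. -/
def pathShift (y : ℕ → ℝ) : ℕ → ℝ := fun n => y (n + 1)

/-- The set `A`: the sequences in `A_1` whose induced process is ergodic. -/
def pathsA : Set (ℕ → ℝ) :=
  {x | x ∈ pathsA1 ∧ ∃ μ : ProbabilityMeasure (ℕ → ℝ), Induces x μ ∧
    Ergodic pathShift (μ : Measure (ℕ → ℝ))}

/-- The limiting frequencies of all products of open intervals along `x` are the probabilities
given by one law on the path space. -/
def HasExactLaw (x : ℕ → ℝ) : Prop :=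
  ∃ μ : ProbabilityMeasure (ℕ → ℝ), ∀ (k : ℕ) (I : Fin k → Set ℝ), (∀ j, IsOpenInterval (I j)) →
    HasDensity (hitSet x I) ((μ : Measure (ℕ → ℝ)).real {y | ∀ j : Fin k, y j ∈ I j})

/-- Asymptotically proportional contraction of the index set: `G` is a union of increasingly
ordered blocks of consecutive integers `G_i = {a_i, …, b_i}` with `|G_i| → ∞`, and `G` has a
positive density. -/
def IsIndexContraction (G : Set ℕ) : Prop :=
  (∃ a b : ℕ → ℕ, (∀ i, a i ≤ b i) ∧ (∀ i, b i < a (i + 1)) ∧ G = ⋃ i, Set.Icc (a i) (b i) ∧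
    Tendsto (fun i => (Finset.Icc (a i) (b i)).card) atTop atTop) ∧
  ∃ c : ℝ, 0 < c ∧ HasDensity G c

/-- `x'` is an asymptotically proportional contraction of `x`: the subsequence of `x` with indices
in an asymptotically proportional contraction `G` of the index set, enumerated increasingly. -/
def IsContraction (x' x : ℕ → ℝ) : Prop :=
  ∃ G : Set ℕ, IsIndexContraction G ∧ x' = fun i => x (Nat.nth (· ∈ G) i)

/-- For every product of open intervals, the limiting frequencies along `x'` and along `x` both
exist and are equal. -/
def SameFrequencies (x' x : ℕ → ℝ) : Prop :=
  ∀ (k : ℕ) (I : Fin k → Set ℝ), (∀ j, IsOpenInterval (I j)) →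
    ∃ p : ℝ, HasDensity (hitSet x' I) p ∧ HasDensity (hitSet x I) p

end

/-! Everything takes place on path space: by `induces_iff`, `x` induces `μ` exactly when the
empirical measures of the orbit of shifted paths of `x` converge weakly to `μ`. Property T gives
tightness and property E identifies all limit points, so every sequence in `pathsA1` induces a
process (`exists_induces`), which is shift-invariant by telescoping.

Suppose `μ` is ergodic and `G` has density `c`. A nonnegative sum over `G` is at most the sum over
all indices, so every limit point `ν` of the empirical measures along `G` satisfies `ν ≤ c⁻¹ μ`.
Block lengths tend to infinity, so block ends are negligible and `ν` is invariant. An invariant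
probability absolutely continuous with respect to an ergodic one equals it, hence `ν = μ`
(`Induces.tendsto_contraction`). The same domination, applied to the error of approximating an
indicator from below, transfers exact frequencies of open boxes even when their frontiers carry mass
(`Induces.hasDensity_hitSet_contraction`).

Conversely, let `B` be invariant with `0 < μ B < 1`. It is approximated by unions of `N + 1`
consecutive shifts of open continuity sets. The times at which the orbit visits such a union form
runs of length at least `N + 1`, up to truncation at time `0`, with density close to `μ B`. Gluing
these time sets over rapidly growing stages gives a contraction of density `μ B` along which a
continuity set `W` has frequency `μ (B ∩ W) / μ B` (`Induces.exists_conditional_contraction`). For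
`W` close to `B` this is near `1`, whereas `μ W` is near `μ B`, so that contraction does not induce
`μ` (`Induces.ergodic`). -/

/-- The uniform distribution on the first `n + 1` terms of a sequence. -/
noncomputable def averageDirac {X : Type*} [MeasurableSpace X] (p : ℕ → X) (n : ℕ) : ProbabilityMeasure X :=
  ⟨((n + 1 : ℕ) : ENNReal)⁻¹ • ∑ i ∈ Finset.range (n + 1), Measure.dirac (p i), by
    constructor
    simp only [Measure.smul_apply, Measure.finsetSum_apply, measure_univ, Finset.sum_const,
      Finset.card_range, smul_eq_mul, nsmul_eq_mul, mul_one]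
    exact ENNReal.inv_mul_cancel (by simp) (ENNReal.natCast_ne_top _)⟩

/-- The `i`-fold shift of a path. -/
def shiftedPath (x : ℕ → ℝ) (i : ℕ) : ℕ → ℝ := fun j => x (i + j)

/-! ### Empirical measures of a sequence of points. -/

section Averages

variable {X : Type*} [MeasurableSpace X]

theorem averageDirac_toMeasure (p : ℕ → X) (n : ℕ) :
    (averageDirac p n : Measure X) =
      ((n + 1 : ℕ) : ENNReal)⁻¹ • ∑ i ∈ Finset.range (n + 1), Measure.dirac (p i) := rfl

theorem integral_averageDirac [MeasurableSingletonClass X] (p : ℕ → X) (n : ℕ) (f : X → ℝ) :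
    ∫ y, f y ∂(averageDirac p n : Measure X) =
      (∑ i ∈ Finset.range (n + 1), f (p i)) / ((n + 1 : ℕ) : ℝ) := by
  rw [averageDirac_toMeasure, integral_smul_measure, integral_finsetSum_measure]
  · rw [ENNReal.toReal_inv, ENNReal.toReal_natCast]
    simp [div_eq_inv_mul]
  · intro i _
    exact integrable_dirac (by simp)

theorem averageDirac_real (p : ℕ → X) (n : ℕ) {S : Set X} (hS : MeasurableSet S) :
    (averageDirac p n : Measure X).real S =
      (∑ i ∈ Finset.range (n + 1), S.indicator (fun _ => (1 : ℝ)) (p i)) / ((n + 1 : ℕ) : ℝ) := by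
  have h (i : ℕ) : ((Measure.dirac (p i)) S).toReal = S.indicator (fun _ => (1 : ℝ)) (p i) := by
    rw [Measure.dirac_apply' _ hS]
    by_cases h : p i ∈ S <;> simp [h]
  rw [Measure.real, averageDirac_toMeasure, Measure.smul_apply, Measure.finsetSum_apply,
    smul_eq_mul, ENNReal.toReal_mul, ENNReal.toReal_sum (fun i _ => measure_ne_top _ _)]
  rw [ENNReal.toReal_inv, ENNReal.toReal_natCast]
  simp only [h, div_eq_inv_mul]

theorem averageDirac_map {Y : Type*} [MeasurableSpace Y] (p : ℕ → X) (n : ℕ) {f : X → Y}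
    (hf : Measurable f) :
    (averageDirac p n).map hf.aemeasurable = averageDirac (fun i => f (p i)) n := by
  apply Subtype.ext
  change Measure.map f (averageDirac p n : Measure X) = _
  rw [averageDirac_toMeasure, Measure.map_smul]
  change _ = ((n + 1 : ℕ) : ENNReal)⁻¹ • ∑ i ∈ Finset.range (n + 1), Measure.dirac (f (p i))
  congr 1
  rw [← Measure.mapₗ_apply_of_measurable hf, map_sum]
  exact Finset.sum_congr rfl fun i _ => by
    rw [Measure.mapₗ_apply_of_measurable hf, Measure.map_dirac' hf]

end Averages

/-! ### Densities as Cesàro averages. -/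

theorem ncard_inter_Iio (S : Set ℕ) (n : ℕ) :
    ((S ∩ Set.Iio n).ncard : ℝ) = ∑ i ∈ Finset.range n, S.indicator (fun _ => (1 : ℝ)) i := by
  classical
  have : S ∩ Set.Iio n = ↑((Finset.range n).filter (· ∈ S)) := by
    ext i; simp [and_comm]
  rw [this, Set.ncard_coe_finset, Finset.card_filter]
  push_cast
  exact Finset.sum_congr rfl fun i _ => by by_cases h : i ∈ S <;> simp [h]

theorem hasDensity_iff (S : Set ℕ) (d : ℝ) : HasDensity S d ↔
    Tendsto (fun n : ℕ => (∑ i ∈ Finset.range n, S.indicator (fun _ => (1 : ℝ)) i) / n)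
      atTop (𝓝 d) := by
  simp only [HasDensity, ncard_inter_Iio]

/-- Empirical measures average `n + 1` terms so as to be probabilities for every `n`, while
densities divide by `n`; this reconciles the two normalisations. -/
theorem tendsto_average_succ_iff (u : ℕ → ℝ) (d : ℝ) :
    Tendsto (fun n : ℕ => (∑ i ∈ Finset.range (n + 1), u i) / ((n + 1 : ℕ) : ℝ)) atTop (𝓝 d) ↔
    Tendsto (fun n : ℕ => (∑ i ∈ Finset.range n, u i) / n) atTop (𝓝 d) :=
  tendsto_add_atTop_iff_nat (f := fun n : ℕ => (∑ i ∈ Finset.range n, u i) / (n : ℝ)) 1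

theorem hasDensity_iff_averageDirac {X : Type*} [MeasurableSpace X] (p : ℕ → X) {S : Set X}
    (hS : MeasurableSet S) (d : ℝ) : HasDensity {i | p i ∈ S} d ↔
    Tendsto (fun n => (averageDirac p n : Measure X).real S) atTop (𝓝 d) := by
  simp only [averageDirac_real p _ hS]
  rw [hasDensity_iff, ← tendsto_average_succ_iff]
  rfl

theorem tendsto_averageDirac_iff {X : Type*} [MeasurableSpace X] [TopologicalSpace X]
    [OpensMeasurableSpace X] [MeasurableSingletonClass X] (p : ℕ → X) (μ : ProbabilityMeasure X) :
    Tendsto (averageDirac p) atTop (𝓝 μ) ↔ ∀ f : BoundedContinuousFunction X ℝ,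
      Tendsto (fun n : ℕ => (∑ i ∈ Finset.range n, f (p i)) / n) atTop
        (𝓝 (∫ y, f y ∂(μ : Measure X))) := by
  rw [ProbabilityMeasure.tendsto_iff_forall_integral_tendsto]
  simp only [integral_averageDirac]
  exact forall_congr' fun f => tendsto_average_succ_iff _ _

theorem tendsto_averageDirac_real {X ι : Type*} [MeasurableSpace X] [TopologicalSpace X]
    [OpensMeasurableSpace X] [HasOuterApproxClosed X] {L : Filter ι}
    {μs : ι → ProbabilityMeasure X} {μ : ProbabilityMeasure X} (h : Tendsto μs L (𝓝 μ))
    {S : Set X} (hS : (μ : Measure X) (frontier S) = 0) :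
    Tendsto (fun i => (μs i : Measure X).real S) L (𝓝 ((μ : Measure X).real S)) :=
  (ENNReal.tendsto_toReal (measure_ne_top _ _)).comp
    (ProbabilityMeasure.tendsto_measure_of_null_frontier_of_tendsto' h hS)

theorem HasDensity.unique {S : Set ℕ} {d d' : ℝ} (h : HasDensity S d) (h' : HasDensity S d') :
    d = d' :=
  tendsto_nhds_unique h h'

theorem HasDensity.mono_zero {S S' : Set ℕ} (h : HasDensity S 0) (hS : S' ⊆ S) :
    HasDensity S' 0 := by
  refine squeeze_zero (fun n => by positivity) (fun n => ?_) h
  gcongr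
  exact (Set.finite_Iio n).subset Set.inter_subset_right

theorem HasDensity.union_zero {S S' : Set ℕ} (h : HasDensity S 0) (h' : HasDensity S' 0) :
    HasDensity (S ∪ S') 0 := by
  have := h.add h'
  rw [add_zero] at this
  refine squeeze_zero (fun n => by positivity) (fun n => ?_) this
  rw [← add_div]
  gcongr
  rw [Set.union_inter_distrib_right]
  exact_mod_cast Set.ncard_union_le _ _

theorem hasDensity_empty : HasDensity ∅ 0 := by
  simp [HasDensity]

theorem tendsto_average_of_eq_off {S : Set ℕ} (hS : HasDensity S 0) {u v : ℕ → ℝ} {C d : ℝ}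
    (hu : ∀ i, |u i - v i| ≤ C) (huv : ∀ i, i ∉ S → u i = v i)
    (h : Tendsto (fun n : ℕ => (∑ i ∈ Finset.range n, v i) / n) atTop (𝓝 d)) :
    Tendsto (fun n : ℕ => (∑ i ∈ Finset.range n, u i) / n) atTop (𝓝 d) := by
  rw [hasDensity_iff] at hS
  have h0 : Tendsto (fun n : ℕ => (∑ i ∈ Finset.range n, (u i - v i)) / (n : ℝ)) atTop (𝓝 0) := by
    have hC := hS.const_mul C
    rw [mul_zero] at hC
    refine squeeze_zero_norm (fun n => ?_) hC
    rw [Real.norm_eq_abs, abs_div, Nat.abs_cast, ← mul_div_assoc, Finset.mul_sum]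
    gcongr
    refine (Finset.abs_sum_le_sum_abs _ _).trans (Finset.sum_le_sum fun i _ => ?_)
    by_cases hi : i ∈ S
    · simpa [hi] using hu i
    · simp [hi, huv i hi]
  have := h0.add h
  rw [zero_add] at this
  refine this.congr fun n => ?_
  rw [← add_div, ← Finset.sum_add_distrib]
  simp

/-! ### Boxes as a convergence-determining class on path space. -/

theorem isOpenInterval_univ : IsOpenInterval Set.univ :=
  ⟨⊥, ⊤, by ext t; simp [EReal.bot_lt_coe, EReal.coe_lt_top]⟩

theorem isOpenInterval_Ioo (a b : ℝ) : IsOpenInterval (Set.Ioo a b) :=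
  ⟨a, b, by ext t; simp⟩

theorem IsOpenInterval.inter {I J : Set ℝ} (hI : IsOpenInterval I) (hJ : IsOpenInterval J) :
    IsOpenInterval (I ∩ J) := by
  obtain ⟨a, b, rfl⟩ := hI
  obtain ⟨c, d, rfl⟩ := hJ
  refine ⟨max a c, min b d, ?_⟩
  ext t
  simp only [Set.mem_inter_iff, Set.mem_ofPred_eq, max_lt_iff, lt_min_iff]
  tauto

theorem IsOpenInterval.isOpen {I : Set ℝ} (hI : IsOpenInterval I) : IsOpen I := by
  obtain ⟨a, b, rfl⟩ := hI
  exact (isOpen_Ioo (a := a) (b := b)).preimage continuous_coe_real_ereal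

theorem frontier_box_subset {ι : Type*} [Finite ι] {I : ι → Set ℝ} (hI : ∀ j, IsOpen (I j)) :
    frontier {y : ι → ℝ | ∀ j, y j ∈ I j} ⊆ ⋃ j, (fun y => y j) ⁻¹' frontier (I j) := by
  have h : {y : ι → ℝ | ∀ j, y j ∈ I j} = Set.univ.pi I := by ext; simp
  rw [h, (isOpen_set_pi Set.finite_univ fun j _ => hI j).frontier_eq, closure_pi_set]
  rintro y ⟨hy, hy'⟩
  simp only [Set.mem_pi, Set.mem_univ, true_implies, not_forall] at hy hy'
  obtain ⟨j, hj⟩ := hy'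
  refine Set.mem_iUnion.2 ⟨j, ?_⟩
  rw [Set.mem_preimage, (hI j).frontier_eq]
  exact ⟨hy j, hj⟩

/-- Cylinders over products of open intervals whose faces are null sets. -/
def continuityBoxes (μ : Measure (ℕ → ℝ)) : Set (Set (ℕ → ℝ)) :=
  {C | ∃ (k : ℕ) (I : ℕ → Set ℝ), (∀ j, IsOpenInterval (I j)) ∧
    (∀ j, μ ((fun y => y j) ⁻¹' frontier (I j)) = 0) ∧ (∀ j, k ≤ j → I j = Set.univ) ∧
    C = {y | ∀ j, y j ∈ I j}}

/-- Families indexed by `ℕ` and trivial from `k` on can be intersected coordinatewise without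
matching lengths; this translates back to `Fin k`. -/
theorem forall_mem_iff_forall_fin {k : ℕ} {I : ℕ → Set ℝ} (hk : ∀ j, k ≤ j → I j = Set.univ)
    (y : ℕ → ℝ) : (∀ j, y j ∈ I j) ↔ ∀ j : Fin k, y j ∈ I j := by
  refine ⟨fun h j => h j, fun h j => ?_⟩
  by_cases hj : j < k
  · exact h ⟨j, hj⟩
  · simp [hk j (not_lt.1 hj)]

theorem isOpen_cylinder {k : ℕ} {I : Fin k → Set ℝ} (hI : ∀ j, IsOpen (I j)) :
    IsOpen {y : ℕ → ℝ | ∀ j : Fin k, y j ∈ I j} := by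
  rw [Set.ofPred_forall]
  exact isOpen_iInter_of_finite fun j => (hI j).preimage (continuous_apply _)

theorem isPiSystem_continuityBoxes (μ : Measure (ℕ → ℝ)) : IsPiSystem (continuityBoxes μ) := by
  rintro _ ⟨k, I, hI, hI', hk, rfl⟩ _ ⟨l, J, hJ, hJ', hl, rfl⟩ -
  refine ⟨max k l, fun j => I j ∩ J j, fun j => (hI j).inter (hJ j), fun j => ?_, fun j hj => ?_, ?_⟩
  · refine measure_mono_null ?_ (measure_union_null (hI' j) (hJ' j))
    rw [← Set.preimage_union]
    refine Set.preimage_mono ((frontier_inter_subset _ _).trans ?_)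
    exact Set.union_subset_union Set.inter_subset_left Set.inter_subset_right
  · simp [hk j (le_of_max_le_left hj), hl j (le_of_max_le_right hj)]
  · ext y
    simp [forall_and]

/-- The level sets of one coordinate are disjoint, so only countably many of them have positive
mass. The remaining levels serve as endpoints of intervals with null faces. -/
theorem dense_null_coordinates (μ : Measure (ℕ → ℝ)) [IsFiniteMeasure μ] :
    Dense {t : ℝ | ∀ j, μ ((fun y => y j) ⁻¹' {t}) = 0} := by
  have h (j : ℕ) : Set.Countable {t : ℝ | 0 < μ ((fun y => y j) ⁻¹' {t})} := by
    refine Measure.countable_meas_pos_of_disjoint_iUnion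
      (fun t => (measurable_pi_apply j) (measurableSet_singleton t)) fun s t hst => ?_
    refine Disjoint.preimage _ ?_
    simpa using hst
  have := (Set.countable_iUnion h).dense_compl ℝ
  convert this using 1
  ext t
  simp

theorem exists_mem_continuityBoxes (μ : Measure (ℕ → ℝ)) [IsFiniteMeasure μ] (u : Set (ℕ → ℝ))
    (hu : IsOpen u) (y : ℕ → ℝ) (hy : y ∈ u) : ∃ s ∈ continuityBoxes μ, s ∈ 𝓝 y ∧ s ⊆ u := by
  classical
  obtain ⟨F, v, hv, hvu⟩ := isOpen_pi_iff.1 hu y hy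
  have key (j : ℕ) : ∃ I : Set ℝ, IsOpenInterval I ∧ μ ((fun y => y j) ⁻¹' frontier I) = 0 ∧
      y j ∈ I ∧ (j ∈ F → I ⊆ v j) ∧ (j ∉ F → I = Set.univ) := by
    by_cases hj : j ∈ F
    · obtain ⟨ε, hε, hball⟩ := Metric.isOpen_iff.1 (hv j hj).1 _ (hv j hj).2
      obtain ⟨a, ha, ha1, ha2⟩ := (dense_null_coordinates μ).exists_between
        (show y j - ε < y j by linarith)
      obtain ⟨b, hb, hb1, hb2⟩ := (dense_null_coordinates μ).exists_between
        (show y j < y j + ε by linarith)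
      refine ⟨Set.Ioo a b, isOpenInterval_Ioo a b, ?_, ⟨ha2, hb1⟩, fun _ => ?_,
        fun h => absurd hj h⟩
      · rw [frontier_Ioo (ha2.trans hb1)]
        have : ({a, b} : Set ℝ) = {a} ∪ {b} := rfl
        rw [this, Set.preimage_union]
        exact measure_union_null (ha j) (hb j)
      · refine Set.Subset.trans ?_ hball
        rw [Real.ball_eq_Ioo]
        exact Set.Ioo_subset_Ioo ha1.le hb2.le
    · exact ⟨Set.univ, isOpenInterval_univ, by simp, trivial, fun h => absurd h hj, fun _ => rfl⟩
  choose I hI hI' hyI hIv hIu using key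
  obtain ⟨k, hk⟩ := F.exists_nat_subset_range
  have hk' : ∀ j, k ≤ j → I j = Set.univ := fun j hj => hIu j fun hF => by
    have := Finset.mem_range.1 (hk hF); omega
  refine ⟨{y | ∀ j, y j ∈ I j}, ⟨k, I, hI, hI', hk', rfl⟩, ?_, ?_⟩
  · refine IsOpen.mem_nhds ?_ hyI
    simp only [forall_mem_iff_forall_fin hk']
    exact isOpen_cylinder fun j => (hI j).isOpen
  · exact fun z hz => hvu fun j hj => hIv j hj (hz j)

theorem measurableSet_of_mem_continuityBoxes {μ : Measure (ℕ → ℝ)} {s : Set (ℕ → ℝ)}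
    (hs : s ∈ continuityBoxes μ) : MeasurableSet s := by
  obtain ⟨k, I, hI, -, hk, rfl⟩ := hs
  simp only [forall_mem_iff_forall_fin hk]
  exact (isOpen_cylinder fun j => (hI j).isOpen).measurableSet

/-- Boxes with null faces form a π-system that contains arbitrarily small neighbourhoods of each
point, and such a class determines weak convergence. -/
theorem tendsto_of_tendsto_continuityBoxes {ι : Type*} {L : Filter ι} [L.IsCountablyGenerated]
    {μs : ι → ProbabilityMeasure (ℕ → ℝ)} {μ : ProbabilityMeasure (ℕ → ℝ)}
    (h : ∀ (k : ℕ) (I : Fin k → Set ℝ), (∀ j, IsOpenInterval (I j)) →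
      (∀ j : Fin k, (μ : Measure (ℕ → ℝ)) ((fun y => y j) ⁻¹' frontier (I j)) = 0) →
      Tendsto (fun i => (μs i : Measure (ℕ → ℝ)).real {y | ∀ j : Fin k, y j ∈ I j}) L
        (𝓝 ((μ : Measure (ℕ → ℝ)).real {y | ∀ j : Fin k, y j ∈ I j}))) :
    Tendsto μs L (𝓝 μ) := by
  refine (isPiSystem_continuityBoxes (μ : Measure (ℕ → ℝ))).tendsto_probabilityMeasure_of_tendsto_of_mem
    (fun s hs => measurableSet_of_mem_continuityBoxes hs)
    (exists_mem_continuityBoxes _) ?_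
  rintro _ ⟨k, I, hI, hI', hk, rfl⟩
  have := h k (fun j => I j) (fun j => hI j) (fun j => hI' j)
  simp only [← forall_mem_iff_forall_fin hk] at this
  simpa using this

/-! ### Inducing a process as weak convergence on path space. -/

theorem finDimLaw_real (μ : ProbabilityMeasure (ℕ → ℝ)) (k : ℕ) {S : Set (Fin k → ℝ)}
    (hS : MeasurableSet S) : (finDimLaw μ k : Measure (Fin k → ℝ)).real S =
      (μ : Measure (ℕ → ℝ)).real ((fun (y : ℕ → ℝ) (j : Fin k) => y j) ⁻¹' S) := by
  rw [Measure.real, Measure.real, finDimLaw, ProbabilityMeasure.map_apply' _ _ hS]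

theorem frontier_cylinder_null {μ : Measure (ℕ → ℝ)} {k : ℕ} {I : Fin k → Set ℝ}
    (hI : ∀ j, IsOpenInterval (I j)) (hI' : ∀ j : Fin k, μ ((fun y => y j) ⁻¹' frontier (I j)) = 0) :
    μ (frontier {y | ∀ j : Fin k, y j ∈ I j}) = 0 := by
  have hc : Continuous fun (y : ℕ → ℝ) (j : Fin k) => y j := by fun_prop
  refine measure_mono_null ((hc.frontier_preimage_subset {z | ∀ j, z j ∈ I j}).trans
    (Set.preimage_mono (frontier_box_subset fun j => (hI j).isOpen))) ?_
  rw [Set.preimage_iUnion]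
  exact measure_iUnion_null fun j => hI' j

theorem tendsto_of_tendsto_finDimLaw {ι : Type*} {L : Filter ι} [L.IsCountablyGenerated]
    {μs : ι → ProbabilityMeasure (ℕ → ℝ)} {μ : ProbabilityMeasure (ℕ → ℝ)}
    (h : ∀ k, Tendsto (fun i => finDimLaw (μs i) k) L (𝓝 (finDimLaw μ k))) :
    Tendsto μs L (𝓝 μ) := by
  refine tendsto_of_tendsto_continuityBoxes fun k I hI hI' => ?_
  have hopen : IsOpen {z : Fin k → ℝ | ∀ j, z j ∈ I j} := by
    rw [Set.ofPred_forall]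
    exact isOpen_iInter_of_finite fun j => (hI j).isOpen.preimage (continuous_apply _)
  have hf : (finDimLaw μ k : Measure (Fin k → ℝ)) (frontier {z | ∀ j, z j ∈ I j}) = 0 := by
    rw [finDimLaw, ProbabilityMeasure.map_apply' _ _ isClosed_frontier.measurableSet]
    refine measure_mono_null
      (Set.preimage_mono (frontier_box_subset fun j => (hI j).isOpen)) ?_
    rw [Set.preimage_iUnion]
    exact measure_iUnion_null fun j => hI' j
  have := tendsto_averageDirac_real (h k) hf
  simpa only [finDimLaw_real _ _ hopen.measurableSet] using! this

theorem tendsto_finDimLaw {ι : Type*} {L : Filter ι} {μs : ι → ProbabilityMeasure (ℕ → ℝ)}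
    {μ : ProbabilityMeasure (ℕ → ℝ)} (h : Tendsto μs L (𝓝 μ)) (k : ℕ) :
    Tendsto (fun i => finDimLaw (μs i) k) L (𝓝 (finDimLaw μ k)) :=
  ProbabilityMeasure.tendsto_map_of_tendsto_of_continuous μs μ h
    (by fun_prop : Continuous fun (y : ℕ → ℝ) (j : Fin k) => y j)

theorem finDimLaw_averageDirac (p : ℕ → ℕ → ℝ) (n k : ℕ) :
    finDimLaw (averageDirac p n) k = averageDirac (fun i (j : Fin k) => p i j) n :=
  averageDirac_map p n (by fun_prop : Measurable fun (y : ℕ → ℝ) (j : Fin k) => y j)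

theorem induces_iff (x : ℕ → ℝ) (μ : ProbabilityMeasure (ℕ → ℝ)) :
    Induces x μ ↔ Tendsto (averageDirac (shiftedPath x)) atTop (𝓝 μ) := by
  have h (k n : ℕ) : empiricalLaw x k n = finDimLaw (averageDirac (shiftedPath x) n) k := by
    rw [finDimLaw_averageDirac]
    rfl
  refine ⟨fun H => tendsto_of_tendsto_finDimLaw fun k => ?_, fun H k => ?_⟩
  · simpa only [h] using H k
  · simpa only [h] using tendsto_finDimLaw H k

theorem hasDensity_hitSet_iff (x : ℕ → ℝ) {k : ℕ} {I : Fin k → Set ℝ}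
    (hI : ∀ j, IsOpenInterval (I j)) (d : ℝ) : HasDensity (hitSet x I) d ↔
    Tendsto (fun n => (averageDirac (shiftedPath x) n : Measure (ℕ → ℝ)).real
      {y | ∀ j : Fin k, y j ∈ I j}) atTop (𝓝 d) :=
  hasDensity_iff_averageDirac (shiftedPath x)
    (isOpen_cylinder fun j => (hI j).isOpen).measurableSet d

theorem induces_of_hasDensity {x : ℕ → ℝ} {μ : ProbabilityMeasure (ℕ → ℝ)}
    (h : ∀ (k : ℕ) (I : Fin k → Set ℝ), (∀ j, IsOpenInterval (I j)) →
      (∀ j : Fin k, (μ : Measure (ℕ → ℝ)) ((fun y => y j) ⁻¹' frontier (I j)) = 0) →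
      HasDensity (hitSet x I) ((μ : Measure (ℕ → ℝ)).real {y | ∀ j : Fin k, y j ∈ I j})) :
    Induces x μ :=
  (induces_iff x μ).2 <| tendsto_of_tendsto_continuityBoxes fun k I hI hI' =>
    (hasDensity_hitSet_iff x hI _).1 (h k I hI hI')

theorem Induces.hasDensity_hitSet {x : ℕ → ℝ} {μ : ProbabilityMeasure (ℕ → ℝ)} (h : Induces x μ)
    {k : ℕ} {I : Fin k → Set ℝ} (hI : ∀ j, IsOpenInterval (I j))
    (hI' : ∀ j : Fin k, (μ : Measure (ℕ → ℝ)) ((fun y => y j) ⁻¹' frontier (I j)) = 0) :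
    HasDensity (hitSet x I) ((μ : Measure (ℕ → ℝ)).real {y | ∀ j : Fin k, y j ∈ I j}) :=
  (hasDensity_hitSet_iff x hI _).2 <|
    tendsto_averageDirac_real ((induces_iff x μ).1 h) (frontier_cylinder_null hI hI')

theorem SameFrequencies.induces {x x' : ℕ → ℝ} {μ : ProbabilityMeasure (ℕ → ℝ)}
    (h : SameFrequencies x' x) (hx : Induces x μ) : Induces x' μ :=
  induces_of_hasDensity fun k I hI hI' => by
    obtain ⟨p, hp', hp⟩ := h k I hI
    rwa [hp.unique (hx.hasDensity_hitSet hI hI')] at hp'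

/-! ### Tightness, existence and invariance of the induced process. -/

theorem continuous_pathShift : Continuous pathShift :=
  continuous_pi fun n => continuous_apply (n + 1)

/-- Distributing `ε` over the coordinates by a summable sequence bounds the mass outside a product
of compact intervals, which is compact by Tychonoff. -/
theorem isTightMeasureSet_of_coordinates {S : Set (ProbabilityMeasure (ℕ → ℝ))}
    (h : ∀ (j : ℕ) (ε : ℝ), 0 < ε → ∃ K : ℝ, ∀ μ ∈ S,
      (μ : Measure (ℕ → ℝ)).real {y | K ≤ |y j|} ≤ ε) :
    IsTightMeasureSet {((μ : ProbabilityMeasure (ℕ → ℝ)) : Measure (ℕ → ℝ)) | μ ∈ S} := by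
  rw [isTightMeasureSet_iff_exists_isCompact_measure_compl_le]
  intro ε hε
  obtain ⟨δ, hδ, hsum⟩ := ENNReal.exists_pos_sum_of_countable hε.ne' ℕ
  choose K hK using fun j => h j (δ j) (hδ j)
  refine ⟨Set.univ.pi fun j => Set.Icc (-K j) (K j), isCompact_univ_pi fun j => isCompact_Icc, ?_⟩
  rintro _ ⟨μ, hμ, rfl⟩
  have hsub : (Set.univ.pi fun j => Set.Icc (-K j) (K j))ᶜ ⊆ ⋃ j, {y : ℕ → ℝ | K j ≤ |y j|} := by
    intro y hy
    simp only [Set.mem_compl_iff, Set.mem_pi, Set.mem_univ, true_implies, not_forall] at hy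
    obtain ⟨j, hj⟩ := hy
    refine Set.mem_iUnion.2 ⟨j, ?_⟩
    by_contra hlt
    exact hj (abs_le.1 (not_le.1 hlt).le)
  refine (measure_mono hsub).trans ((measure_iUnion_le _).trans ?_)
  refine (ENNReal.tsum_le_tsum fun j => ?_).trans hsum.le
  have := hK j μ hμ
  rw [← ENNReal.ofReal_coe_nnreal]
  exact (ENNReal.le_ofReal_iff_toReal_le (measure_ne_top _ _) (by positivity)).2 this

theorem PropertyT.exists_bound {x : ℕ → ℝ} (hx : PropertyT x) {ε : ℝ} (hε : 0 < ε) :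
    ∃ K : ℝ, ∀ n : ℕ,
      ∑ i ∈ Finset.range n, {i | K ≤ |x i|}.indicator (fun _ => (1 : ℝ)) i ≤ ε * n := by
  obtain ⟨d, hd, hlim⟩ := hx
  obtain ⟨K₀, hK₀⟩ := (hlim.eventually (lt_mem_nhds (show 1 - ε < 1 by linarith))).exists
  have hd₀ := (hasDensity_iff _ _).1 (hd K₀)
  obtain ⟨n₀, hn₀⟩ := eventually_atTop.1
    ((hd₀.eventually (lt_mem_nhds hK₀)).and (eventually_gt_atTop 0))
  obtain ⟨M, hM⟩ := ((Finset.range n₀).image fun i => |x i|).exists_le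
  -- `K₀` works for `n ≥ n₀`; exceeding `M` makes the count zero for the finitely many smaller `n`.
  refine ⟨max K₀ (M + 1), fun n => ?_⟩
  rcases lt_or_ge n n₀ with hn | hn
  · rw [Finset.sum_eq_zero]
    · positivity
    · intro i hi
      have hi' : |x i| ≤ M := hM _ (Finset.mem_image_of_mem _
        (Finset.mem_range.2 ((Finset.mem_range.1 hi).trans hn)))
      refine Set.indicator_of_notMem (fun h => ?_) _
      have : M + 1 ≤ |x i| := (le_max_right _ _).trans h
      linarith
  · obtain ⟨h1, h2⟩ := hn₀ n hn
    have hn' : (0 : ℝ) < n := by exact_mod_cast h2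
    rw [lt_div_iff₀ hn'] at h1
    have h3 : ∑ i ∈ Finset.range n, {i | max K₀ (M + 1) ≤ |x i|}.indicator (fun _ => (1 : ℝ)) i +
        ∑ i ∈ Finset.range n, {i | |x i| < K₀}.indicator (fun _ => (1 : ℝ)) i ≤ n := by
      rw [← Finset.sum_add_distrib]
      refine (Finset.sum_le_card_nsmul _ _ 1 fun i _ => ?_).trans (by simp)
      by_cases ha : |x i| < K₀
      · have : ¬ (max K₀ (M + 1) ≤ |x i|) := fun h => by
          have := (le_max_left _ _).trans h; linarith
        simp only [Set.indicator, Set.mem_ofPred_eq, if_neg this, if_pos ha]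
        norm_num
      · simp only [Set.indicator, Set.mem_ofPred_eq, if_neg ha, add_zero]
        split_ifs <;> norm_num
    linarith

theorem sum_comp_strictMono_le {g : ℕ → ℕ} (hg : StrictMono g) {u : ℕ → ℝ} (hu : ∀ i, 0 ≤ u i)
    (n : ℕ) : ∑ i ∈ Finset.range (n + 1), u (g i) ≤ ∑ i ∈ Finset.range (g n + 1), u i := by
  rw [← Finset.sum_image (f := u) hg.injective.injOn]
  refine Finset.sum_le_sum_of_subset_of_nonneg (fun m hm => ?_) fun i _ _ => hu i
  obtain ⟨i, hi, rfl⟩ := Finset.mem_image.1 hm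
  rw [Finset.mem_range] at hi ⊢
  have := hg.monotone (Nat.lt_succ_iff.1 hi)
  omega

theorem isCompact_closure_range_averageDirac {x : ℕ → ℝ} (hx : PropertyT x) {g : ℕ → ℕ}
    (hg : StrictMono g) {C : ℝ} (hC : ∀ n, (g n : ℝ) ≤ C * (n + 1)) :
    IsCompact (closure (Set.range (averageDirac fun i => shiftedPath x (g i)))) := by
  refine isCompact_closure_of_isTightMeasureSet (isTightMeasureSet_of_coordinates fun j ε hε => ?_)
  have hC0 : 0 ≤ C := by
    have := hC 0
    have h0 : (0 : ℝ) ≤ g 0 := by positivity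
    norm_num at this
    linarith
  -- Coordinate `j` of the first `n + 1` paths uses indices of `x` up to `g n + j`, that is, among
  -- at most `(C + (j + 1)) * (n + 1)` indices.
  obtain ⟨K, hK⟩ := hx.exists_bound (show 0 < ε / (C + (j + 1)) by positivity)
  refine ⟨K, ?_⟩
  rintro _ ⟨n, rfl⟩
  have hm : MeasurableSet {y : ℕ → ℝ | K ≤ |y j|} :=
    measurableSet_le measurable_const (by fun_prop)
  rw [averageDirac_real _ _ hm, div_le_iff₀ (by positivity)]
  have h1 := sum_comp_strictMono_le (g := fun i => g i + j) (fun a b hab => by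
    have := hg hab
    simpa using this) (u := {i | K ≤ |x i|}.indicator (fun _ => (1 : ℝ)))
    (fun i => Set.indicator_nonneg (fun _ _ => zero_le_one) i) n
  refine le_trans h1 ((hK _).trans ?_)
  have h2 : ((g n + j + 1 : ℕ) : ℝ) ≤ (C + (j + 1)) * ((n + 1 : ℕ) : ℝ) := by
    push_cast
    nlinarith [hC n, (by positivity : (0 : ℝ) ≤ (j + 1) * n)]
  calc ε / (C + (j + 1)) * ((g n + j + 1 : ℕ) : ℝ)
      ≤ ε / (C + (j + 1)) * ((C + (j + 1)) * ((n + 1 : ℕ) : ℝ)) := by gcongr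
    _ = ε * ((n + 1 : ℕ) : ℝ) := by field_simp

theorem PropertyE.exists_hasDensity {x : ℕ → ℝ} (hx : PropertyE x) {k : ℕ} {I : Fin k → Set ℝ}
    (hI : ∀ j, IsOpenInterval (I j)) : ∃ d, HasDensity (hitSet x I) d := by
  rcases hx k I hI with h | ⟨d, -, h⟩
  · exact ⟨0, h ▸ hasDensity_empty⟩
  · exact ⟨d, h⟩

/-- Compactness gives a limit along an ultrafilter. Property E provides genuine limits of all box
frequencies, which must agree with those of the ultrafilter limit on continuity boxes. -/
theorem exists_induces {x : ℕ → ℝ} (hx : x ∈ pathsA1) : ∃ μ, Induces x μ := by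
  have hc := isCompact_closure_range_averageDirac hx.2 (g := id) strictMono_id (C := 1)
    (fun n => by simp)
  obtain ⟨μ, -, hμ⟩ := hc.ultrafilter_le_nhds
    ((hyperfilter ℕ).map (averageDirac (shiftedPath x))) (by
      rw [le_principal_iff]
      exact Filter.mem_of_superset (Filter.mem_map.2 (by simp [Set.preimage_range]))
        subset_closure)
  have hμ' : Tendsto (averageDirac (shiftedPath x)) (hyperfilter ℕ : Filter ℕ) (𝓝 μ) := hμ
  refine ⟨μ, induces_of_hasDensity fun k I hI hI' => ?_⟩
  obtain ⟨d, hd⟩ := hx.1.exists_hasDensity hI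
  have h1 := tendsto_averageDirac_real hμ' (frontier_cylinder_null hI hI')
  have h2 := ((hasDensity_hitSet_iff x hI d).1 hd).mono_left Nat.hyperfilter_le_atTop
  rwa [tendsto_nhds_unique h1 h2]

/-- The sum of `f (p (i + 1)) - f (p i)` telescopes and is bounded, so its averages vanish. The
exceptional set `D` accommodates jumps between blocks, and a general `L` covers ultrafilter limits.
-/
theorem measurePreserving_pathShift_of_tendsto {p : ℕ → ℕ → ℝ} {D : Set ℕ} (hD : HasDensity D 0)
    (hp : ∀ i, i ∉ D → pathShift (p i) = p (i + 1)) {L : Filter ℕ} [L.NeBot] (hL : L ≤ atTop)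
    {μ : ProbabilityMeasure (ℕ → ℝ)} (h : Tendsto (averageDirac p) L (𝓝 μ)) :
    MeasurePreserving pathShift (μ : Measure (ℕ → ℝ)) μ := by
  refine ⟨continuous_pathShift.measurable, ?_⟩
  have : IsProbabilityMeasure (Measure.map pathShift (μ : Measure (ℕ → ℝ))) :=
    Measure.isProbabilityMeasure_map continuous_pathShift.measurable.aemeasurable
  refine ext_of_forall_integral_eq_of_IsFiniteMeasure fun f => ?_
  rw [integral_map continuous_pathShift.measurable.aemeasurable
    f.continuous.aestronglyMeasurable]
  rw [ProbabilityMeasure.tendsto_iff_forall_integral_tendsto] at h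
  have h1 := h f
  have h2 := h (f.compContinuous ⟨pathShift, continuous_pathShift⟩)
  simp only [integral_averageDirac] at h1 h2
  have h3 := h2.sub h1
  simp only [← sub_div, ← Finset.sum_sub_distrib] at h3
  have habs (y : ℕ → ℝ) : |f y| ≤ ‖f‖ := f.norm_coe_le_norm y
  have h4 : Tendsto (fun n : ℕ => (∑ i ∈ Finset.range n, (f (p (i + 1)) - f (p i))) / (n : ℝ))
      atTop (𝓝 0) := by
    simp only [Finset.sum_range_sub (fun i => f (p i))]
    refine squeeze_zero_norm (fun n => ?_)
      (tendsto_const_nhds.div_atTop tendsto_natCast_atTop_atTop :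
        Tendsto (fun n : ℕ => (‖f‖ + ‖f‖) / (n : ℝ)) atTop (𝓝 0))
    rw [norm_div, Real.norm_natCast]
    gcongr
    exact (norm_sub_le _ _).trans (add_le_add (f.norm_coe_le_norm _) (f.norm_coe_le_norm _))
  have h5 := tendsto_average_of_eq_off hD
    (u := fun i => f (pathShift (p i)) - f (p i)) (C := ‖f‖ + ‖f‖)
    (fun i => by
      have e : f (pathShift (p i)) - f (p i) - (f (p (i + 1)) - f (p i)) =
        f (pathShift (p i)) - f (p (i + 1)) := by ring
      rw [e]
      exact (abs_sub _ _).trans (add_le_add (habs _) (habs _)))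
    (fun i hi => by rw [hp i hi]) h4
  have h6 := ((tendsto_average_succ_iff _ _).2 h5).mono_left hL
  exact sub_eq_zero.1 (tendsto_nhds_unique h3 h6)

theorem Induces.measurePreserving {x : ℕ → ℝ} {μ : ProbabilityMeasure (ℕ → ℝ)}
    (h : Induces x μ) : MeasurePreserving pathShift (μ : Measure (ℕ → ℝ)) μ :=
  measurePreserving_pathShift_of_tendsto hasDensity_empty
    (fun i _ => by ext j; simp only [pathShift, shiftedPath]; congr 1; omega) le_rfl
    ((induces_iff x μ).1 h)

/-! ### Block ends of a contraction are negligible. -/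

theorem hasDensity_zero_range {b : ℕ → ℕ} (hb : ∀ L : ℕ, ∀ᶠ i in atTop, b i + L ≤ b (i + 1)) :
    HasDensity (Set.range b) 0 := by
  refine Metric.tendsto_nhds.2 fun ε hε => ?_
  -- Gaps of at least `L` give density at most `1 / L < ε / 2`; the finitely many initial terms
  -- account for the other half.
  obtain ⟨L, hL⟩ := exists_nat_gt (2 / ε)
  have hL0 : (0 : ℝ) < L := (by positivity : (0 : ℝ) < 2 / ε).trans hL
  obtain ⟨i₀, hi₀⟩ := eventually_atTop.1 (hb L)
  have hgrow (q : ℕ) : q * L ≤ b (i₀ + q) := by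
    induction q with
    | zero => simp
    | succ q ih =>
      have := hi₀ (i₀ + q) (by omega)
      rw [add_mul, one_mul]
      exact (Nat.add_le_add_right ih L).trans this
  have hcount (n : ℕ) : (Set.range b ∩ Set.Iio n).ncard ≤ i₀ + n / L + 1 := by
    have hsub : Set.range b ∩ Set.Iio n ⊆ b '' ↑(Finset.range (i₀ + n / L + 1)) := by
      rintro _ ⟨⟨i, rfl⟩, hi⟩
      refine ⟨i, ?_, rfl⟩
      rw [Finset.coe_range, Set.mem_Iio]
      rcases lt_or_ge i i₀ with h | h
      · exact h.trans_le (by rw [add_assoc]; exact Nat.le_add_right _ _)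
      · obtain ⟨q, rfl⟩ := Nat.exists_eq_add_of_le h
        have h1 : q * L ≤ n := (hgrow q).trans (le_of_lt hi)
        have := (Nat.le_div_iff_mul_le (by exact_mod_cast hL0)).2 h1
        rw [add_assoc, Nat.add_lt_add_iff_left]
        exact Nat.lt_succ_of_le this
    refine (Set.ncard_le_ncard hsub ((Finset.finite_toSet _).image b)).trans ?_
    refine (Set.ncard_image_le (Finset.finite_toSet _)).trans ?_
    rw [Set.ncard_coe_finset, Finset.card_range]
  have hlim : Tendsto (fun n : ℕ => ((i₀ : ℝ) + 1) / n) atTop (𝓝 0) :=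
    tendsto_const_nhds.div_atTop tendsto_natCast_atTop_atTop
  filter_upwards [hlim.eventually (gt_mem_nhds (half_pos hε)), eventually_gt_atTop 0] with n hn hn0
  have hn0' : (0 : ℝ) < n := by exact_mod_cast hn0
  rw [Real.dist_eq, sub_zero, abs_of_nonneg (by positivity)]
  have h1 : ((Set.range b ∩ Set.Iio n).ncard : ℝ) ≤ (i₀ + 1) + n / L := by
    have h2 : ((n / L : ℕ) : ℝ) ≤ n / L := Nat.cast_div_le
    have h3 : ((Set.range b ∩ Set.Iio n).ncard : ℝ) ≤ ((i₀ + n / L + 1 : ℕ) : ℝ) := by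
      exact_mod_cast hcount n
    push_cast at h3
    linarith
  calc ((Set.range b ∩ Set.Iio n).ncard : ℝ) / n ≤ ((i₀ + 1) + n / L) / n := by gcongr
    _ = (i₀ + 1) / n + 1 / L := by field_simp
    _ < ε / 2 + ε / 2 := by
      refine add_lt_add hn ?_
      rw [div_lt_iff₀ hL0]
      rw [div_lt_iff₀ hε] at hL
      linarith
    _ = ε := by ring

theorem HasDensity.preimage_add {S : Set ℕ} (hS : HasDensity S 0) (j : ℕ) :
    HasDensity {n | n + j ∈ S} 0 := by
  induction j with
  | zero => simpa using hS
  | succ j ih =>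
    rw [hasDensity_iff] at ih ⊢
    have h : Tendsto (fun n : ℕ => (1 : ℝ) / n) atTop (𝓝 0) :=
      tendsto_const_nhds.div_atTop tendsto_natCast_atTop_atTop
    have h2 := ih.add h
    rw [add_zero] at h2
    refine squeeze_zero (fun n => ?_) (fun n => ?_) h2
    · exact div_nonneg (Finset.sum_nonneg fun i _ => Set.indicator_nonneg
        (fun _ _ => zero_le_one) i) (Nat.cast_nonneg n)
    · rw [← add_div]
      gcongr
      set u : ℕ → ℝ := {n | n + j ∈ S}.indicator (fun _ => (1 : ℝ)) with hu
      have e (i : ℕ) : {n | n + (j + 1) ∈ S}.indicator (fun _ => (1 : ℝ)) i = u (i + 1) := by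
        have : i + (j + 1) = i + 1 + j := by ring
        by_cases hi : i + 1 + j ∈ S <;> simp [hu, this, hi]
      simp only [e]
      have h3 := Finset.sum_range_succ' u n
      have h4 := Finset.sum_range_succ u n
      have h5 : 0 ≤ u 0 := Set.indicator_nonneg (fun _ _ => zero_le_one) _
      have h6 : u n ≤ 1 := Set.indicator_le' (fun _ _ => le_rfl) (fun _ _ => zero_le_one) n
      linarith

/-- The elements of `G` whose `k` successors do not all belong to `G`. -/
def nearEnds (G : Set ℕ) (k : ℕ) : Set ℕ := {n | n ∈ G ∧ ∃ j ≤ k, n + j ∉ G}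

theorem hasDensity_nearEnds {G : Set ℕ} (hG : IsIndexContraction G) (k : ℕ) :
    HasDensity (nearEnds G k) 0 := by
  obtain ⟨⟨a, b, hab, hba, rfl, hcard⟩, -⟩ := hG
  -- An element whose immediate successor leaves `G` is the right end of a block, and gaps between
  -- right ends are at least the block lengths. In the induction, leaving `G` first after `k + 1`
  -- steps means that `n + k` is of this kind.
  have h1 : HasDensity (nearEnds (⋃ i, Set.Icc (a i) (b i)) 1) 0 := by
    refine (hasDensity_zero_range (b := b) fun L => ?_).mono_zero ?_
    · filter_upwards [(tendsto_add_atTop_iff_nat 1).2 hcard |>.eventually (eventually_ge_atTop L)]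
        with i hi
      rw [Nat.card_Icc] at hi
      have := hba i
      have := hab (i + 1)
      omega
    · rintro n ⟨hn, j, hj, hnj⟩
      obtain ⟨i, hi⟩ := Set.mem_iUnion.1 hn
      refine ⟨i, ?_⟩
      have : n + j ∉ Set.Icc (a i) (b i) := fun h => hnj (Set.mem_iUnion.2 ⟨i, h⟩)
      simp only [Set.mem_Icc] at hi this
      omega
  induction k with
  | zero =>
    convert hasDensity_empty
    ext n
    simp only [nearEnds, Nat.le_zero, Set.mem_ofPred_eq, Set.mem_empty_iff_false, iff_false]
    rintro ⟨h, j, rfl, h'⟩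
    exact h' h
  | succ k ih =>
    refine (ih.union_zero (h1.preimage_add k)).mono_zero ?_
    rintro n ⟨hn, j, hj, hnj⟩
    by_cases h : ∃ j ≤ k, n + j ∉ ⋃ i, Set.Icc (a i) (b i)
    · exact Or.inl ⟨hn, h⟩
    · push Not at h
      have hj' : j = k + 1 := by
        by_contra hne
        exact hnj (h j (by omega))
      subst hj'
      exact Or.inr ⟨h k le_rfl, 1, le_rfl, hnj⟩

theorem IsIndexContraction.infinite {G : Set ℕ} (hG : IsIndexContraction G) : G.Infinite := by
  obtain ⟨⟨a, b, hab, hba, rfl, -⟩, -⟩ := hG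
  have ha : StrictMono a := strictMono_nat_of_lt_succ fun i => (hab i).trans_lt (hba i)
  exact Set.infinite_of_injective_forall_mem ha.injective fun i =>
    Set.mem_iUnion.2 ⟨i, le_rfl, hab i⟩

theorem sum_comp_nth {G : Set ℕ} (hG : G.Infinite) (u : ℕ → ℝ) (n : ℕ) :
    ∑ i ∈ Finset.range (n + 1), u (Nat.nth (· ∈ G) i) =
      ∑ m ∈ Finset.range (Nat.nth (· ∈ G) n + 1), G.indicator u m := by
  classical
  have hmono : StrictMono (Nat.nth (· ∈ G)) := Nat.nth_strictMono hG
  rw [← Finset.sum_image (f := u) hmono.injective.injOn]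
  simp only [Set.indicator_apply]
  rw [← Finset.sum_filter]
  refine Finset.sum_congr ?_ fun _ _ => rfl
  ext m
  simp only [Finset.mem_image, Finset.mem_range, Finset.mem_filter]
  constructor
  · rintro ⟨i, hi, rfl⟩
    exact ⟨Nat.lt_succ_iff.2 (hmono.monotone (Nat.lt_succ_iff.1 hi)), Nat.nth_mem_of_infinite hG i⟩
  · rintro ⟨hm, hmG⟩
    refine ⟨Nat.count (· ∈ G) m, ?_, Nat.nth_count hmG⟩
    rw [← hmono.lt_iff_lt, Nat.nth_count hmG]
    exact hm.trans_le (Nat.succ_le_of_lt (hmono (Nat.lt_succ_self n)))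

/-- The first `n + 1` elements of `G` are those up to its `n`-th one, so the inverse ratio is the
density of `G` sampled just past that element. -/
theorem tendsto_nth_div {G : Set ℕ} (hG : G.Infinite) {c : ℝ} (hc : 0 < c) (h : HasDensity G c) :
    Tendsto (fun n : ℕ => ((Nat.nth (· ∈ G) n + 1 : ℕ) : ℝ) / ((n + 1 : ℕ) : ℝ)) atTop
      (𝓝 c⁻¹) := by
  have hmono : StrictMono (Nat.nth (· ∈ G)) := Nat.nth_strictMono hG
  have h1 := ((hasDensity_iff _ _).1 h).comp
    (tendsto_atTop_mono (fun n => Nat.le_succ _) hmono.tendsto_atTop)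
  refine (h1.inv₀ hc.ne').congr fun n => ?_
  have := sum_comp_nth hG (fun _ => 1) n
  simp only [Function.comp_apply, Nat.succ_eq_add_one]
  rw [← this]
  simp

theorem tendsto_average_nth {G : Set ℕ} (hG : G.Infinite) {c : ℝ} (hc : 0 < c)
    (h : HasDensity G c) {u : ℕ → ℝ} {d : ℝ}
    (hu : Tendsto (fun n : ℕ => (∑ i ∈ Finset.range n, G.indicator u i) / n) atTop (𝓝 d)) :
    Tendsto (fun n : ℕ => (∑ i ∈ Finset.range n, u (Nat.nth (· ∈ G) i)) / n) atTop
      (𝓝 (d / c)) := by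
  have hmono : StrictMono (Nat.nth (· ∈ G)) := Nat.nth_strictMono hG
  rw [← tendsto_average_succ_iff]
  have h1 := hu.comp (tendsto_atTop_mono (fun n => Nat.le_succ _) hmono.tendsto_atTop)
  refine (h1.mul (tendsto_nth_div hG hc h)).congr fun n => ?_
  simp only [Function.comp_apply, Nat.succ_eq_add_one, sum_comp_nth hG]
  have : ((Nat.nth (· ∈ G) n + 1 : ℕ) : ℝ) ≠ 0 := by positivity
  field_simp

theorem HasDensity.comp_nth {G : Set ℕ} (hG : G.Infinite) {c : ℝ} (hc : 0 < c)
    (h : HasDensity G c) {S : Set ℕ} {d : ℝ} (hS : HasDensity (G ∩ S) d) :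
    HasDensity {i | Nat.nth (· ∈ G) i ∈ S} (d / c) := by
  rw [hasDensity_iff] at hS ⊢
  refine tendsto_average_nth hG hc h (u := S.indicator fun _ => 1) ?_
  simpa only [Set.indicator_indicator] using hS

theorem nth_add_of_notMem_nearEnds {G : Set ℕ} (hG : G.Infinite) {k i : ℕ}
    (hi : Nat.nth (· ∈ G) i ∉ nearEnds G k) {j : ℕ} (hj : j ≤ k) :
    Nat.nth (· ∈ G) (i + j) = Nat.nth (· ∈ G) i + j := by
  classical
  have hmem (j : ℕ) (hj : j ≤ k) : Nat.nth (· ∈ G) i + j ∈ G := by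
    by_contra hn
    exact hi ⟨Nat.nth_mem_of_infinite hG i, j, hj, hn⟩
  induction j with
  | zero => rfl
  | succ j ih =>
    have ih' := ih (by omega)
    have h1 := Nat.count_nth_succ_of_infinite (p := (· ∈ G)) hG (i + j)
    rw [ih'] at h1
    have h2 := Nat.nth_count (p := (· ∈ G)) (hmem (j + 1) hj)
    rw [← add_assoc, h1] at h2
    rw [← add_assoc, ← add_assoc, h2]

theorem hasDensity_nth_nearEnds {G : Set ℕ} (hG : IsIndexContraction G) (k : ℕ) :
    HasDensity {i | Nat.nth (· ∈ G) i ∈ nearEnds G k} 0 := by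
  obtain ⟨c, hc, h⟩ := hG.2
  simpa using HasDensity.comp_nth hG.infinite hc h
    ((hasDensity_nearEnds hG k).mono_zero (S' := G ∩ nearEnds G k) Set.inter_subset_right)

theorem shiftedPath_contraction {G : Set ℕ} (hG : G.Infinite) (x : ℕ → ℝ) {k i : ℕ}
    (hi : Nat.nth (· ∈ G) i ∉ nearEnds G k) {j : ℕ} (hj : j ≤ k) :
    shiftedPath (fun i => x (Nat.nth (· ∈ G) i)) i j = shiftedPath x (Nat.nth (· ∈ G) i) j := by
  simp only [shiftedPath, nth_add_of_notMem_nearEnds hG hi hj]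

/-- Windows of the contracted sequence and windows of `x` at the retained indices differ only near
block ends, a set of density zero. The right-hand side involves true shifted paths of `x`, which can
be compared with the full orbit. -/
theorem induces_contraction_iff {G : Set ℕ} (hG : IsIndexContraction G) (x : ℕ → ℝ)
    (μ : ProbabilityMeasure (ℕ → ℝ)) : Induces (fun i => x (Nat.nth (· ∈ G) i)) μ ↔
      Tendsto (averageDirac fun i => shiftedPath x (Nat.nth (· ∈ G) i)) atTop (𝓝 μ) := by
  have heq (k i : ℕ) (hi : i ∉ {i | Nat.nth (· ∈ G) i ∈ nearEnds G k}) :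
      (fun j : Fin k => shiftedPath (fun i => x (Nat.nth (· ∈ G) i)) i j) =
        fun j : Fin k => shiftedPath x (Nat.nth (· ∈ G) i) j :=
    funext fun j => shiftedPath_contraction hG.infinite x hi j.2.le
  have hb {k : ℕ} (f : BoundedContinuousFunction (Fin k → ℝ) ℝ) (y z : Fin k → ℝ) :
      |f y - f z| ≤ ‖f‖ + ‖f‖ :=
    (abs_sub _ _).trans (add_le_add (f.norm_coe_le_norm _) (f.norm_coe_le_norm _))
  rw [induces_iff]
  refine ⟨fun H => tendsto_of_tendsto_finDimLaw fun k => ?_,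
    fun H => tendsto_of_tendsto_finDimLaw fun k => ?_⟩ <;>
  · have := tendsto_finDimLaw H k
    simp only [finDimLaw_averageDirac] at this ⊢
    refine (tendsto_averageDirac_iff _ _).2 fun f => ?_
    refine tendsto_average_of_eq_off (hasDensity_nth_nearEnds hG k) (fun i => hb f _ _)
      (fun i hi => ?_) ((tendsto_averageDirac_iff _ _).1 this f)
    rw [heq k i hi]

/-! ### Ergodicity forces contractions to induce the same process. -/

/-- The inequality passes from test functions to closed sets by outer approximation; inner
regularity by closed sets then handles Borel null sets. -/
theorem absolutelyContinuous_of_lintegral_le {X : Type*} [MeasurableSpace X] [TopologicalSpace X]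
    [TopologicalSpace.PseudoMetrizableSpace X] [BorelSpace X] {μ ν : Measure X} [IsFiniteMeasure μ]
    [IsFiniteMeasure ν] {K : NNReal}
    (h : ∀ f : BoundedContinuousFunction X NNReal,
      ∫⁻ y, f y ∂ν ≤ K * ∫⁻ y, f y ∂μ) : ν ≪ μ := by
  refine Measure.AbsolutelyContinuous.mk fun s hs hμs => ?_
  by_contra hν
  obtain ⟨F, hFs, hF, hpos⟩ := hs.exists_lt_isClosed_of_ne_top (measure_ne_top ν s)
    (pos_iff_ne_zero.2 hν)
  have h1 := HasOuterApproxClosed.tendsto_lintegral_apprSeq hF ν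
  have h2 := ENNReal.Tendsto.const_mul (a := (K : ENNReal))
    (HasOuterApproxClosed.tendsto_lintegral_apprSeq hF μ) (Or.inr ENNReal.coe_ne_top)
  have h3 := le_of_tendsto_of_tendsto' h1 h2 fun n => h _
  rw [measure_mono_null hFs hμs, mul_zero] at h3
  exact hpos.not_ge h3

/-- The source of the domination `ν ≤ c⁻¹ μ`: discarding indices outside `G` decreases a nonnegative
sum, and the change of normalisation costs a factor tending to `c⁻¹`. -/
theorem average_comp_nth_le {G : Set ℕ} (hG : G.Infinite) {u : ℕ → ℝ} (hu : ∀ i, 0 ≤ u i) (n : ℕ) :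
    (∑ i ∈ Finset.range (n + 1), u (Nat.nth (· ∈ G) i)) / ((n + 1 : ℕ) : ℝ) ≤
      ((Nat.nth (· ∈ G) n + 1 : ℕ) : ℝ) / ((n + 1 : ℕ) : ℝ) *
      ((∑ m ∈ Finset.range (Nat.nth (· ∈ G) n + 1), u m) /
        ((Nat.nth (· ∈ G) n + 1 : ℕ) : ℝ)) := by
  have h := sum_comp_strictMono_le (Nat.nth_strictMono (p := (· ∈ G)) hG) hu n
  have h0 : ((Nat.nth (· ∈ G) n + 1 : ℕ) : ℝ) ≠ 0 := by positivity
  rw [div_mul_div_comm, mul_comm, mul_div_mul_right _ _ h0]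
  gcongr

theorem tendsto_average_bound {G : Set ℕ} (hG : G.Infinite) {c : ℝ} (hc : 0 < c)
    (h : HasDensity G c) {u : ℕ → ℝ} {d : ℝ}
    (hu : Tendsto (fun n : ℕ => (∑ i ∈ Finset.range n, u i) / n) atTop (𝓝 d)) :
    Tendsto (fun n : ℕ => ((Nat.nth (· ∈ G) n + 1 : ℕ) : ℝ) / ((n + 1 : ℕ) : ℝ) *
      ((∑ m ∈ Finset.range (Nat.nth (· ∈ G) n + 1), u m) /
        ((Nat.nth (· ∈ G) n + 1 : ℕ) : ℝ))) atTop (𝓝 (c⁻¹ * d)) :=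
  (tendsto_nth_div hG hc h).mul (hu.comp (tendsto_atTop_mono (fun _ => Nat.le_succ _)
    (Nat.nth_strictMono (p := (· ∈ G)) hG).tendsto_atTop))

theorem Induces.tendsto_contraction {x : ℕ → ℝ} (hx : PropertyT x)
    {μ : ProbabilityMeasure (ℕ → ℝ)} (hμ : Induces x μ)
    (herg : Ergodic pathShift (μ : Measure (ℕ → ℝ))) {G : Set ℕ} (hG : IsIndexContraction G) :
    Tendsto (averageDirac fun i => shiftedPath x (Nat.nth (· ∈ G) i)) atTop (𝓝 μ) := by
  have hinf := hG.infinite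
  obtain ⟨c, hc, hdens⟩ := hG.2
  obtain ⟨C, hC⟩ := (tendsto_nth_div hinf hc hdens).bddAbove_range
  have hgC (n : ℕ) : (Nat.nth (· ∈ G) n : ℝ) ≤ C * (n + 1) := by
    have := hC (Set.mem_range_self n)
    rw [div_le_iff₀ (by positivity)] at this
    push_cast at this
    linarith
  have hcomp := isCompact_closure_range_averageDirac hx
    (Nat.nth_strictMono (p := (· ∈ G)) hinf) hgC
  -- In a relatively compact family it suffices that every cluster point equals `μ`; an ultrafilter
  -- realises the given one as a limit.
  refine hcomp.tendsto_nhds_of_unique_mapClusterPt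
    (Eventually.of_forall fun n => subset_closure (Set.mem_range_self n)) fun ν _ hν => ?_
  obtain ⟨U, hU, hUν⟩ := mapClusterPt_iff_ultrafilter.1 hν
  have hinv := measurePreserving_pathShift_of_tendsto (hasDensity_nth_nearEnds hG 1)
    (fun i hi => by
      ext j
      rw [shiftedPath, nth_add_of_notMem_nearEnds hinf hi le_rfl]
      simp only [pathShift, shiftedPath]
      congr 1
      omega) hU hUν
  have habs : (ν : Measure (ℕ → ℝ)) ≪ μ := by
    refine absolutelyContinuous_of_lintegral_le (K := ⟨c⁻¹, (inv_pos.2 hc).le⟩) fun f => ?_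
    let f' : BoundedContinuousFunction (ℕ → ℝ) ℝ :=
      ⟨⟨fun y => (f y : ℝ), NNReal.continuous_coe.comp f.continuous⟩, f.map_bounded'⟩
    have hle : ∫ y, f' y ∂(ν : Measure (ℕ → ℝ)) ≤ c⁻¹ * ∫ y, f' y ∂(μ : Measure (ℕ → ℝ)) := by
      have h1 := (ProbabilityMeasure.tendsto_iff_forall_integral_tendsto.1 hUν) f'
      simp only [integral_averageDirac] at h1
      have h2 := (tendsto_average_bound hinf hc hdens
        ((tendsto_averageDirac_iff _ _).1 ((induces_iff x μ).1 hμ) f')).mono_left hU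
      exact le_of_tendsto_of_tendsto' h1 h2 fun n =>
        average_comp_nth_le hinf (u := fun i => f' (shiftedPath x i)) (fun i => (f _).2) n
    have e (ρ : Measure (ℕ → ℝ)) [IsFiniteMeasure ρ] :
        ∫⁻ y, f y ∂ρ = ENNReal.ofReal (∫ y, f' y ∂ρ) := by
      have h1 : ∫ y, f' y ∂ρ = (∫⁻ y, f y ∂ρ).toReal :=
        (BoundedContinuousFunction.toReal_lintegral_coe_eq_integral f ρ).symm
      rw [h1, ENNReal.ofReal_toReal (BoundedContinuousFunction.lintegral_lt_top_of_nnreal ρ f).ne]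
    rw [e, e]
    refine (ENNReal.ofReal_le_ofReal hle).trans_eq ?_
    rw [ENNReal.ofReal_mul (inv_pos.2 hc).le]
    congr 1
    exact ENNReal.ofReal_eq_coe_nnreal _
  exact ProbabilityMeasure.toMeasure_injective (herg.eq_of_absolutelyContinuous hinv habs)

theorem Induces.contraction {x x' : ℕ → ℝ} (hx : PropertyT x)
    {μ : ProbabilityMeasure (ℕ → ℝ)} (hμ : Induces x μ)
    (herg : Ergodic pathShift (μ : Measure (ℕ → ℝ))) (hx' : IsContraction x' x) :
    Induces x' μ := by
  obtain ⟨G, hG, rfl⟩ := hx'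
  exact (induces_contraction_iff hG x μ).2 (hμ.tendsto_contraction hx herg hG)

theorem IsOpen.exists_boundedContinuous_le_indicator {X : Type*} [MeasurableSpace X]
    [TopologicalSpace X] [HasOuterApproxClosed X] [OpensMeasurableSpace X] {W : Set X}
    (hW : IsOpen W) (μ : Measure X) [IsProbabilityMeasure μ] {ε : ℝ} (hε : 0 < ε) :
    ∃ f : BoundedContinuousFunction X ℝ, (∀ y, f y ≤ W.indicator (fun _ => (1 : ℝ)) y) ∧
      μ.real W - ε < ∫ y, f y ∂μ := by
  obtain ⟨N, hN⟩ := ((HasOuterApproxClosed.tendsto_lintegral_apprSeq hW.isClosed_compl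
    μ).eventually (gt_mem_nhds (ENNReal.lt_add_right (measure_ne_top μ Wᶜ)
      (ENNReal.ofReal_pos.2 hε).ne'))).exists
  let a : BoundedContinuousFunction X ℝ :=
    ⟨⟨fun y => (hW.isClosed_compl.apprSeq N y : ℝ),
      NNReal.continuous_coe.comp (hW.isClosed_compl.apprSeq N).continuous⟩,
      (hW.isClosed_compl.apprSeq N).map_bounded'⟩
  have ha : ∫ y, a y ∂μ < μ.real Wᶜ + ε := by
    have h1 : ∫ y, a y ∂μ = (∫⁻ y, hW.isClosed_compl.apprSeq N y ∂μ).toReal :=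
      (BoundedContinuousFunction.toReal_lintegral_coe_eq_integral _ μ).symm
    rw [h1]
    have h2 := (ENNReal.toReal_lt_toReal (hN.trans (by finiteness)).ne (by finiteness)).2 hN
    rwa [ENNReal.toReal_add (measure_ne_top _ _) ENNReal.ofReal_ne_top,
      ENNReal.toReal_ofReal hε.le] at h2
  refine ⟨1 - a, fun y => ?_, ?_⟩
  · have h0 : 0 ≤ a y := (hW.isClosed_compl.apprSeq N y).2
    by_cases hy : y ∈ W
    · simpa [hy] using h0
    · have : a y = 1 := by
        have := HasOuterApproxClosed.apprSeq_apply_eq_one hW.isClosed_compl N hy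
        exact congrArg NNReal.toReal this
      simp [hy, this]
  · have h3 : ∫ y, (1 - a) y ∂μ = 1 - ∫ y, a y ∂μ := by
      simp only [BoundedContinuousFunction.coe_sub, BoundedContinuousFunction.coe_one,
        Pi.sub_apply, Pi.one_apply]
      rw [integral_sub (integrable_const _) (a.integrable μ)]
      simp
    rw [h3]
    have := probReal_compl_eq_one_sub (μ := μ) hW.measurableSet
    linarith

/-- Weak convergence alone is insufficient, since the frontier of the box may have positive mass.
With `f` continuous below the indicator `w`, the error `w - f` is nonnegative and has small average
along `x` by `hd`, hence along `G` by domination. -/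
theorem Induces.hasDensity_hitSet_contraction {x x' : ℕ → ℝ} (hx : PropertyT x)
    {μ : ProbabilityMeasure (ℕ → ℝ)} (hμ : Induces x μ)
    (herg : Ergodic pathShift (μ : Measure (ℕ → ℝ))) (hx' : IsContraction x' x) {k : ℕ}
    {I : Fin k → Set ℝ} (hI : ∀ j, IsOpenInterval (I j))
    (hd : HasDensity (hitSet x I) ((μ : Measure (ℕ → ℝ)).real {y | ∀ j : Fin k, y j ∈ I j})) :
    HasDensity (hitSet x' I) ((μ : Measure (ℕ → ℝ)).real {y | ∀ j : Fin k, y j ∈ I j}) := by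
  obtain ⟨G, hG, rfl⟩ := hx'
  have hinf := hG.infinite
  have hlim := hμ.tendsto_contraction hx herg hG
  obtain ⟨c, hc, hdens⟩ := hG.2
  have hWo : IsOpen {y : ℕ → ℝ | ∀ j : Fin k, y j ∈ I j} := isOpen_cylinder fun j => (hI j).isOpen
  set W := {y : ℕ → ℝ | ∀ j : Fin k, y j ∈ I j} with hW
  set w : (ℕ → ℝ) → ℝ := W.indicator (fun _ => (1 : ℝ)) with hw
  have key : Tendsto (fun n : ℕ => (∑ i ∈ Finset.range n,
      w (shiftedPath x (Nat.nth (· ∈ G) i))) / (n : ℝ)) atTop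
      (𝓝 ((μ : Measure (ℕ → ℝ)).real W)) := by
    rw [← tendsto_average_succ_iff, Metric.tendsto_nhds]
    intro ε hε
    have hc' : 0 < c⁻¹ := inv_pos.2 hc
    -- The error budget is `δ` for the average of `f`, `δ` for its integral, and `(1 + c⁻¹) * δ` for
    -- `w - f`.
    obtain ⟨δ, hδ, hδε⟩ : ∃ δ : ℝ, 0 < δ ∧ (3 + c⁻¹) * δ = ε :=
      ⟨ε / (3 + c⁻¹), by positivity, by field_simp⟩
    obtain ⟨f, hfw, hf⟩ := hWo.exists_boundedContinuous_le_indicator (μ : Measure (ℕ → ℝ)) hδ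
    have hfW : ∫ y, f y ∂(μ : Measure (ℕ → ℝ)) ≤ (μ : Measure (ℕ → ℝ)).real W := by
      rw [← integral_indicator_one hWo.measurableSet]
      exact integral_mono (f.integrable _)
        ((integrable_const (1 : ℝ)).indicator hWo.measurableSet) hfw
    have h1 := (tendsto_average_succ_iff _ _).2 ((tendsto_averageDirac_iff _ _).1 hlim f)
    have h2 : Tendsto (fun n : ℕ => (∑ i ∈ Finset.range n,
        (w (shiftedPath x i) - f (shiftedPath x i))) / (n : ℝ)) atTop
        (𝓝 ((μ : Measure (ℕ → ℝ)).real W - ∫ y, f y ∂(μ : Measure (ℕ → ℝ)))) := by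
      simp only [Finset.sum_sub_distrib, sub_div]
      refine Tendsto.sub ?_ ((tendsto_averageDirac_iff _ _).1 ((induces_iff x μ).1 hμ) f)
      exact (hasDensity_iff _ _).1 hd
    have h3 := tendsto_average_bound hinf hc hdens h2
    have h4 : c⁻¹ * ((μ : Measure (ℕ → ℝ)).real W - ∫ y, f y ∂(μ : Measure (ℕ → ℝ))) ≤ c⁻¹ * δ := by
      gcongr
      linarith
    filter_upwards [(Metric.tendsto_nhds.1 h1) δ hδ,
      h3.eventually (gt_mem_nhds (show _ < c⁻¹ * δ + δ by linarith))] with n hn1 hn2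
    have hn3 := average_comp_nth_le hinf (u := fun i => w (shiftedPath x i) - f (shiftedPath x i))
      (fun i => sub_nonneg.2 (hfw _)) n
    have hn4 : 0 ≤ (∑ i ∈ Finset.range (n + 1), (w (shiftedPath x (Nat.nth (· ∈ G) i)) -
        f (shiftedPath x (Nat.nth (· ∈ G) i)))) / ((n + 1 : ℕ) : ℝ) :=
      div_nonneg (Finset.sum_nonneg fun i _ => sub_nonneg.2 (hfw _)) (Nat.cast_nonneg _)
    have hn5 := hn3.trans_lt hn2
    rw [Finset.sum_sub_distrib, sub_div] at hn4 hn5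
    rw [Real.dist_eq, abs_lt] at hn1 ⊢
    have hcδ : 0 < c⁻¹ * δ := mul_pos hc' hδ
    constructor <;> nlinarith
  classical
  rw [hasDensity_iff]
  refine tendsto_average_of_eq_off (hasDensity_nth_nearEnds hG k) (C := 1) (fun i => ?_)
    (fun i hi => ?_) key
  · simp only [hw, Set.indicator_apply]
    split_ifs <;> norm_num
  · have h1 : i ∈ hitSet (fun i => x (Nat.nth (· ∈ G) i)) I ↔
        shiftedPath x (Nat.nth (· ∈ G) i) ∈ W := by
      refine forall_congr' fun j => ?_
      rw [← shiftedPath_contraction hinf x hi j.2.le]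
      rfl
    simp only [hw, Set.indicator_apply, h1]

/-! ### Gluing along rapidly growing stages. -/

/-- The index of the interval `[s j, s (j + 1))` that contains `m`. -/
def stage (s : ℕ → ℕ) (m : ℕ) : ℕ := Nat.findGreatest (fun j => s j ≤ m) m

section Stage

variable {s : ℕ → ℕ}

/-- Bounding the search by `m` loses nothing because `N ≤ s N`, and `s 0 = 0` ensures that a
candidate exists. -/
theorem le_stage_iff (hs : StrictMono s) (h0 : s 0 = 0) {N m : ℕ} : N ≤ stage s m ↔ s N ≤ m := by
  constructor
  · intro h
    have h1 : s (stage s m) ≤ m :=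
      Nat.findGreatest_spec (P := fun j => s j ≤ m) (m := 0) (Nat.zero_le m) (by simp [h0])
    exact (hs.monotone h).trans h1
  · exact fun h => Nat.le_findGreatest ((hs.le_apply).trans h) h

theorem stage_eq_iff (hs : StrictMono s) (h0 : s 0 = 0) {N m : ℕ} :
    stage s m = N ↔ s N ≤ m ∧ m < s (N + 1) := by
  rw [← le_stage_iff hs h0, ← not_le, ← le_stage_iff hs h0]
  omega

theorem tendsto_stage (hs : StrictMono s) (h0 : s 0 = 0) : Tendsto (stage s) atTop atTop :=
  tendsto_atTop.2 fun N => eventually_atTop.2 ⟨s N, fun _ hm => (le_stage_iff hs h0).2 hm⟩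

theorem stage_mono (hs : StrictMono s) (h0 : s 0 = 0) : Monotone (stage s) := fun _ _ h =>
  (le_stage_iff hs h0).2 (((le_stage_iff hs h0).1 le_rfl).trans h)

end Stage

/-- Sequences whose averages are eventually small can be glued along a rapidly increasing sequence
of times into one sequence whose averages tend to zero. -/
theorem exists_glue {E : Type*} [SeminormedAddCommGroup E] {v : ℕ → ℕ → E} {C : ℝ} (hC : 0 ≤ C)
    (hv : ∀ N i, ‖v N i‖ ≤ C) {ε : ℕ → ℝ} (hε0 : ∀ N, 0 ≤ ε N) (hε : Tendsto ε atTop (𝓝 0))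
    (hvε : ∀ N, ∀ᶠ n : ℕ in atTop, ‖∑ i ∈ Finset.range n, v N i‖ ≤ ε N * n) (q : ℕ → ℕ) :
    ∃ s : ℕ → ℕ, s 0 = 0 ∧ (∀ N, s N + (N + 1) ≤ s (N + 1)) ∧ (∀ N, q (N + 1) ≤ s (N + 1)) ∧
      Tendsto (fun n : ℕ => ‖∑ i ∈ Finset.range n, v (stage s i) i‖ / n) atTop (𝓝 0) := by
  choose M hM using fun N => eventually_atTop.1 (hvε N)
  -- The summands serve, in order, the prescribed growth, the time after which the stage's bound
  -- holds, the dominance over everything before the stage, and the gap.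
  let s : ℕ → ℕ := fun N => Nat.rec 0 (fun N t => q (N + 1) + M (N + 1) + (N + 1) * t + t + (N + 1)) N
  have hs0 : s 0 = 0 := rfl
  have hs (N : ℕ) : s (N + 1) = q (N + 1) + M (N + 1) + (N + 1) * s N + s N + (N + 1) := rfl
  have hmono : StrictMono s := strictMono_nat_of_lt_succ fun N => by
    have := hs N
    generalize (N + 1) * s N = t at this
    omega
  refine ⟨s, hs0, fun N => by rw [hs N]; omega, fun N => by rw [hs N]; omega, ?_⟩
  set S : ℕ → E := fun n => ∑ i ∈ Finset.range n, v (stage s i) i with hS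
  have hSC (n : ℕ) : ‖S n‖ ≤ C * n := by
    refine (norm_sum_le _ _).trans ((Finset.sum_le_sum fun i _ => hv _ i).trans_eq ?_)
    simp [mul_comm]
  have hstep (N m : ℕ) (h1 : s N ≤ m) (h2 : m ≤ s (N + 1)) :
      S m = S (s N) + ((∑ i ∈ Finset.range m, v N i) - ∑ i ∈ Finset.range (s N), v N i) := by
    rw [hS]
    simp only
    rw [← Finset.sum_range_add_sum_Ico _ h1, ← Finset.sum_range_add_sum_Ico (v N) h1,
      add_sub_cancel_left]
    congr 1
    refine Finset.sum_congr rfl fun i hi => ?_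
    rw [Finset.mem_Ico] at hi
    rw [(stage_eq_iff hmono hs0).2 ⟨hi.1, by omega⟩]
  -- The part of the sum within a stage is a difference of two initial sums of that stage's
  -- sequence, whence the factor `2`.
  have hbound (N m : ℕ) (h1 : s (N + 1) ≤ m) (h2 : m ≤ s (N + 2)) :
      ‖S m‖ ≤ ‖S (s (N + 1))‖ + 2 * ε (N + 1) * m := by
    have hMs : M (N + 1) ≤ s (N + 1) := by rw [hs N]; omega
    rw [hstep (N + 1) m h1 h2]
    have e1 := hM (N + 1) m (hMs.trans h1)
    have e2 := hM (N + 1) (s (N + 1)) hMs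
    have e3 : ε (N + 1) * (s (N + 1) : ℕ) ≤ ε (N + 1) * m := by
      have := hε0 (N + 1)
      gcongr
    refine (norm_add_le _ _).trans ?_
    have := norm_sub_le (∑ i ∈ Finset.range m, v (N + 1) i)
      (∑ i ∈ Finset.range (s (N + 1)), v (N + 1) i)
    linarith
  have hη : Tendsto (fun N : ℕ => C / ((N + 1 : ℕ) : ℝ) + 2 * ε (N + 1) + 2 * ε (N + 2)) atTop
      (𝓝 0) := by
    have e1 : Tendsto (fun N : ℕ => C / ((N + 1 : ℕ) : ℝ)) atTop (𝓝 0) :=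
      tendsto_const_nhds.div_atTop
        (tendsto_natCast_atTop_atTop.comp (tendsto_add_atTop_nat 1))
    have e2 := ((tendsto_add_atTop_iff_nat 1).2 hε).const_mul 2
    have e3 := ((tendsto_add_atTop_iff_nat 2).2 hε).const_mul 2
    simpa using (e1.add e2).add e3
  -- The current and the preceding stage are controlled by `ε`; everything before `s (N + 1)` is
  -- bounded trivially by `C` and is a fraction at most `1 / (N + 1)` of `m`.
  have hfinal (N m : ℕ) (h1 : s (N + 2) ≤ m) (h2 : m ≤ s (N + 3)) :
      ‖S m‖ / m ≤ C / ((N + 1 : ℕ) : ℝ) + 2 * ε (N + 1) + 2 * ε (N + 2) := by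
    have hm : 0 < m := (Nat.zero_le _).trans_lt ((hmono (Nat.succ_pos (N + 1))).trans_le h1)
    have hm' : (0 : ℝ) < m := by exact_mod_cast hm
    rw [div_le_iff₀ hm']
    have e1 := hbound (N + 1) m h1 h2
    have e2 := hbound N (s (N + 2)) (hmono (Nat.lt_succ_self (N + 1))).le le_rfl
    have e3 := hSC (s (N + 1))
    have h1' : ((s (N + 2) : ℕ) : ℝ) ≤ m := by exact_mod_cast h1
    have e4 : C * s (N + 1) ≤ C / ((N + 1 : ℕ) : ℝ) * m := by
      have e5 : (N + 1) * s (N + 1) ≤ m := by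
        refine le_trans ?_ h1
        rw [hs (N + 1)]
        nlinarith
      have e6 : ((N + 1 : ℕ) : ℝ) * s (N + 1) ≤ m := by exact_mod_cast e5
      rw [div_mul_eq_mul_div, le_div_iff₀ (by positivity)]
      nlinarith
    have e7 : 2 * ε (N + 1) * (s (N + 2) : ℕ) ≤ 2 * ε (N + 1) * m := by
      have := hε0 (N + 1)
      gcongr
    rw [add_mul, add_mul]
    linarith
  have hst : Tendsto (fun m => stage s m - 2) atTop atTop :=
    (tendsto_sub_atTop_nat 2).comp (tendsto_stage hmono hs0)
  refine squeeze_zero' (Eventually.of_forall fun n => by positivity) ?_ (hη.comp hst)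
  filter_upwards [(tendsto_stage hmono hs0).eventually (eventually_ge_atTop 2)] with m hm
  obtain ⟨N, hN⟩ := Nat.exists_eq_add_of_le' hm
  have := (stage_eq_iff hmono hs0).1 hN
  have h3 := hfinal N m this.1 this.2.le
  simp only [Function.comp_apply, hN]
  exact h3

theorem HasDensity.congr_off {S S' Z : Set ℕ} {d : ℝ} (h : HasDensity S d) (hZ : HasDensity Z 0)
    (hS : ∀ n, n ∉ Z → (n ∈ S' ↔ n ∈ S)) : HasDensity S' d := by
  classical
  rw [hasDensity_iff] at h ⊢
  refine tendsto_average_of_eq_off hZ (C := 1) (fun i => ?_) (fun i hi => ?_) h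
  · simp only [Set.indicator_apply]
    split_ifs <;> norm_num
  · simp only [Set.indicator_apply, hS i hi]

/-- In stage `N` at most quadratically many (in `N`) boundary places have been met, whereas the time
is at least cubic in `N`. -/
theorem hasDensity_stage_boundaries {s : ℕ → ℕ} (h0 : s 0 = 0)
    (hs : ∀ N, s N + (N + 1) ≤ s (N + 1)) (hq : ∀ N, (N + 3) ^ 3 ≤ s (N + 1)) :
    HasDensity (⋃ j, Set.Ico (s j - j) (s j)) 0 := by
  have hmono : StrictMono s := strictMono_nat_of_lt_succ fun N => by
    have := hs N
    omega
  have hcount (m : ℕ) : ((⋃ j, Set.Ico (s j - j) (s j)) ∩ Set.Iio m).ncard ≤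
      (stage s m + 2) * (stage s m + 2) := by
    set N := stage s m with hN
    have hsub : (⋃ j, Set.Ico (s j - j) (s j)) ∩ Set.Iio m ⊆
        ↑((Finset.range (N + 2)).biUnion fun j => Finset.Ico (s j - j) (s j)) := by
      rintro n ⟨hn, hnm⟩
      obtain ⟨j, hj⟩ := Set.mem_iUnion.1 hn
      rw [Set.mem_Ico] at hj
      simp only [Finset.coe_biUnion, Finset.coe_range, Set.mem_Iio, Finset.coe_Ico,
        Set.mem_iUnion, Set.mem_Ico, exists_prop]
      refine ⟨j, ?_, hj⟩
      by_contra hlt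
      -- The `j` places before `s j` start no earlier than `s (j - 1)`, which exceeds `m` once `j ≥
      -- N + 2`.
      obtain ⟨i, rfl⟩ : ∃ i, j = N + 1 + i + 1 := ⟨j - (N + 2), by omega⟩
      have h1 := ((stage_eq_iff hmono h0).1 hN.symm).2
      have h2 := hmono.monotone (show N + 1 ≤ N + 1 + i by omega)
      have h3 := hs (N + 1 + i)
      have h4 : n < m := hnm
      omega
    refine (Set.ncard_le_ncard hsub (Finset.finite_toSet _)).trans ?_
    rw [Set.ncard_coe_finset]
    refine Finset.card_biUnion_le.trans ((Finset.sum_le_card_nsmul _ _ (N + 2) fun j hj => ?_).trans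
      (by simp))
    rw [Nat.card_Ico]
    have := Finset.mem_range.1 hj
    omega
  have hlim : Tendsto (fun m => (1 : ℝ) / ((stage s m + 2 : ℕ) : ℝ)) atTop (𝓝 0) :=
    tendsto_const_nhds.div_atTop (tendsto_natCast_atTop_atTop.comp
      ((tendsto_add_atTop_nat 2).comp (tendsto_stage hmono h0)))
  refine squeeze_zero' (Eventually.of_forall fun n => by positivity) ?_ hlim
  filter_upwards [(tendsto_stage hmono h0).eventually (eventually_ge_atTop 1)] with m hm
  obtain ⟨N, hN⟩ := Nat.exists_eq_add_of_le' hm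
  have h1 := hcount m
  rw [hN] at h1 ⊢
  have h2 : (N + 3) ^ 3 ≤ m := (hq N).trans ((stage_eq_iff hmono h0).1 hN).1
  have h3 : (((⋃ j, Set.Ico (s j - j) (s j)) ∩ Set.Iio m).ncard : ℝ) ≤ ((N : ℝ) + 3) * (N + 3) := by
    have : ((⋃ j, Set.Ico (s j - j) (s j)) ∩ Set.Iio m).ncard ≤ (N + 3) * (N + 3) := h1
    exact_mod_cast this
  have h4 : ((N : ℝ) + 3) ^ 3 ≤ m := by exact_mod_cast h2
  have h5 : (0 : ℝ) < (N : ℝ) + 3 := by positivity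
  have h6 : (0 : ℝ) < m := (by positivity : (0 : ℝ) < ((N : ℝ) + 3) ^ 3).trans_le h4
  push_cast
  rw [div_le_div_iff₀ h6 (by positivity)]
  nlinarith

/-- The blocks are the maximal runs of `G`, finite since the complement is infinite, and enumerated
by their starting points. Every far element lies in a long run, so their lengths tend to infinity.
-/
theorem exists_blocks {G : Set ℕ} (hG : G.Infinite) (hG' : Gᶜ.Infinite)
    (hrun : ∀ L : ℕ, ∀ᶠ n in atTop, n ∈ G → ∃ l r, l ≤ n ∧ n ≤ r ∧ Set.Icc l r ⊆ G ∧ l + L ≤ r + 1) :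
    ∃ a b : ℕ → ℕ, (∀ i, a i ≤ b i) ∧ (∀ i, b i < a (i + 1)) ∧ G = ⋃ i, Set.Icc (a i) (b i) ∧
      Tendsto (fun i => (Finset.Icc (a i) (b i)).card) atTop atTop := by
  classical
  have hex (n : ℕ) : ∃ r, n ≤ r ∧ r ∉ G := by
    obtain ⟨r, hr, hnr⟩ := hG'.exists_gt n
    exact ⟨r, hnr.le, hr⟩
  let e : ℕ → ℕ := fun n => Nat.find (hex n)
  have he (n : ℕ) : n ≤ e n ∧ e n ∉ G := Nat.find_spec (hex n)
  have hlt (n m : ℕ) (h1 : n ≤ m) (h2 : m < e n) : m ∈ G := by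
    have := Nat.find_min (hex n) h2
    by_contra h
    exact this ⟨h1, h⟩
  have hle (n m : ℕ) (h1 : n ≤ m) (h2 : m ∉ G) : e n ≤ m := Nat.find_min' (hex n) ⟨h1, h2⟩
  have helt (n : ℕ) (hn : n ∈ G) : n < e n :=
    lt_of_le_of_ne (he n).1 fun h => (he n).2 (h ▸ hn)
  let St : Set ℕ := {n | n ∈ G ∧ ∀ m, m + 1 = n → m ∉ G}
  have hstart (n : ℕ) (hn : n ∈ G) : ∃ l ∈ St, l ≤ n ∧ Set.Icc l n ⊆ G := by
    have hl : ∃ l, l ≤ n ∧ Set.Icc l n ⊆ G := ⟨n, le_rfl, by simpa using hn⟩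
    obtain ⟨h1, h2⟩ := Nat.find_spec hl
    refine ⟨Nat.find hl, ⟨h2 ⟨le_rfl, h1⟩, fun m hm hmG => ?_⟩, h1, h2⟩
    refine Nat.find_min hl (show m < Nat.find hl by omega) ⟨by omega, fun j hj => ?_⟩
    rcases eq_or_lt_of_le hj.1 with h | h
    · exact h ▸ hmG
    · exact h2 ⟨by omega, hj.2⟩
  have hSt : St.Infinite := by
    refine Set.infinite_of_not_bddAbove ?_
    rintro ⟨M, hM⟩
    obtain ⟨n, hn, hMn⟩ := hG.exists_gt (e M)
    obtain ⟨l, hl, hln, hlG⟩ := hstart n hn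
    have h1 : l ≤ M := hM hl
    exact (he M).2 (hlG ⟨h1.trans (he M).1, hMn.le⟩)
  have ha (i : ℕ) : Nat.nth (· ∈ St) i ∈ St := Nat.nth_mem_of_infinite hSt i
  have hamono : StrictMono (Nat.nth (· ∈ St)) := Nat.nth_strictMono hSt
  refine ⟨Nat.nth (· ∈ St), fun i => e (Nat.nth (· ∈ St) i) - 1, fun i => ?_, fun i => ?_, ?_, ?_⟩
  · exact Nat.le_sub_one_of_lt (helt _ (ha i).1)
  · have hi : Nat.nth (· ∈ St) i < Nat.nth (· ∈ St) (i + 1) := hamono (Nat.lt_succ_self i)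
    obtain ⟨m, hm⟩ : ∃ m, m + 1 = Nat.nth (· ∈ St) (i + 1) :=
      ⟨Nat.nth (· ∈ St) (i + 1) - 1, by omega⟩
    have h1 := hle (Nat.nth (· ∈ St) i) m (by omega) ((ha (i + 1)).2 m hm)
    change e (Nat.nth (· ∈ St) i) - 1 < _
    omega
  · ext n
    simp only [Set.mem_iUnion, Set.mem_Icc]
    constructor
    · intro hn
      obtain ⟨l, hl, hln, hlG⟩ := hstart n hn
      refine ⟨Nat.count (· ∈ St) l, ?_⟩
      rw [Nat.nth_count (p := (· ∈ St)) hl]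
      refine ⟨hln, ?_⟩
      have : n < e l := by
        by_contra h
        exact (he l).2 (hlG ⟨(he l).1, not_lt.1 h⟩)
      omega
    · rintro ⟨i, h1, h2⟩
      have := helt _ (ha i).1
      exact hlt _ n h1 (by omega)
  · refine tendsto_atTop.2 fun L => ?_
    filter_upwards [hamono.tendsto_atTop.eventually (hrun L)] with i hi
    obtain ⟨l, r, hl, hr, hlr, hL⟩ := hi (ha i).1
    have hle' : Nat.nth (· ∈ St) i ≤ l := by
      by_contra h
      exact (ha i).2 (Nat.nth (· ∈ St) i - 1) (by omega) (hlr ⟨by omega, by omega⟩)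
    have hr' : r < e (Nat.nth (· ∈ St) i) := by
      by_contra h
      exact (he _).2 (hlr ⟨by have := (he (Nat.nth (· ∈ St) i)).1; omega, not_lt.1 h⟩)
    rw [Nat.card_Icc]
    omega

theorem Set.Finite.hasDensity_zero {S : Set ℕ} (hS : S.Finite) : HasDensity S 0 := by
  have h : Tendsto (fun n : ℕ => (S.ncard : ℝ) / n) atTop (𝓝 0) :=
    tendsto_const_nhds.div_atTop tendsto_natCast_atTop_atTop
  refine squeeze_zero (fun n => by positivity) (fun n => ?_) h
  gcongr
  exact Set.inter_subset_left

theorem hasDensity_univ : HasDensity Set.univ 1 := by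
  rw [hasDensity_iff]
  refine (tendsto_const_nhds (x := (1 : ℝ))).congr' ?_
  filter_upwards [eventually_gt_atTop 0] with n hn
  have : (n : ℝ) ≠ 0 := by positivity
  simp [this]

theorem HasDensity.infinite {S : Set ℕ} {d : ℝ} (h : HasDensity S d) (hd : d ≠ 0) : S.Infinite :=
  fun hS => hd (h.unique hS.hasDensity_zero)

theorem HasDensity.infinite_compl {S : Set ℕ} {d : ℝ} (h : HasDensity S d) (hd : d ≠ 1) :
    Sᶜ.Infinite := fun hS =>
  hd (h.unique (hasDensity_univ.congr_off hS.hasDensity_zero (by simp)))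

/-- If the sets `{n : n + j ∈ Q N for some j ≤ N}` have densities tending to a number strictly
between `0` and `1`, then they can be glued into an index contraction with the limit density, in
which the relative frequencies of a given set `P` also pass to the limit. -/
theorem exists_isIndexContraction (Q : ℕ → Set ℕ) (P : Set ℕ) {d e : ℕ → ℝ} {β γ : ℝ}
    (hd : ∀ N, HasDensity {n | ∃ j ≤ N, n + j ∈ Q N} (d N))
    (he : ∀ N, HasDensity ({n | ∃ j ≤ N, n + j ∈ Q N} ∩ P) (e N))
    (hdβ : Tendsto d atTop (𝓝 β)) (heγ : Tendsto e atTop (𝓝 γ)) (hβ0 : 0 < β) (hβ1 : β < 1) :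
    ∃ G : Set ℕ, IsIndexContraction G ∧ HasDensity G β ∧ HasDensity (G ∩ P) γ := by
  classical
  set H : ℕ → Set ℕ := fun N => {n | ∃ j ≤ N, n + j ∈ Q N} with hH
  let ind : Set ℕ → ℕ → ℝ := fun S => S.indicator fun _ => 1
  have hind (S : Set ℕ) (i : ℕ) : |ind S i| ≤ 1 := by
    simp only [ind, Set.indicator_apply]
    split_ifs <;> norm_num
  -- Pairing both centred indicators makes one choice of stages serve both densities.
  let v : ℕ → ℕ → ℝ × ℝ := fun N i => (ind (H N) i - β, ind (H N ∩ P) i - γ)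
  have hvC (N i : ℕ) : ‖v N i‖ ≤ 1 + |β| + |γ| := by
    have h1 := (abs_sub (ind (H N) i) β).trans (add_le_add_left (hind _ _) _)
    have h2 := (abs_sub (ind (H N ∩ P) i) γ).trans (add_le_add_left (hind _ _) _)
    refine max_le ?_ ?_
    · have := abs_nonneg γ
      exact h1.trans (by linarith)
    · have := abs_nonneg β
      exact h2.trans (by linarith)
  have haux {S : Set ℕ} {δ t ε : ℝ} (h : HasDensity S δ) (hε : |δ - t| < ε) :
      ∀ᶠ n : ℕ in atTop, |∑ i ∈ Finset.range n, (ind S i - t)| ≤ ε * n := by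
    have h1 := (((hasDensity_iff _ _).1 h).sub_const t).abs
    filter_upwards [h1.eventually (gt_mem_nhds hε), eventually_gt_atTop 0] with n hn hn0
    have hn0' : (0 : ℝ) < n := by exact_mod_cast hn0
    have e1 : ∑ i ∈ Finset.range n, (ind S i - t) =
        ((∑ i ∈ Finset.range n, S.indicator (fun _ => (1 : ℝ)) i) / n - t) * n := by
      rw [Finset.sum_sub_distrib]
      simp only [ind, Finset.sum_const, Finset.card_range, nsmul_eq_mul]
      field_simp
    rw [e1, abs_mul, abs_of_pos hn0']
    gcongr
  obtain ⟨s, hs0, hs, hq, hglue⟩ := exists_glue (by positivity) hvC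
    (ε := fun N : ℕ => |d N - β| + |e N - γ| + 1 / ((N : ℝ) + 1)) (fun N => by positivity)
    (by
      have e1 := (hdβ.sub_const β).abs
      have e2 := (heγ.sub_const γ).abs
      rw [sub_self, abs_zero] at e1 e2
      simpa using (e1.add e2).add tendsto_one_div_add_atTop_nhds_zero_nat)
    (fun N => by
      have h1 : 0 < 1 / ((N : ℝ) + 1) := by positivity
      have h2 := abs_nonneg (d N - β)
      have h3 := abs_nonneg (e N - γ)
      filter_upwards [haux (hd N) (show |d N - β| < _ by linarith :
          |d N - β| < |d N - β| + |e N - γ| + 1 / ((N : ℝ) + 1)),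
        haux (he N) (show |e N - γ| < _ by linarith :
          |e N - γ| < |d N - β| + |e N - γ| + 1 / ((N : ℝ) + 1))] with n hn1 hn2
      rw [Prod.norm_def, Prod.fst_sum, Prod.snd_sum]
      exact max_le hn1 hn2) (fun N => (N + 2) ^ 3)
  have hmono : StrictMono s := strictMono_nat_of_lt_succ fun N => by
    have := hs N
    omega
  have hback (S : ℕ → Set ℕ) (t : ℝ) (w : ℕ → ℕ → ℝ) (hw : ∀ N i, w N i = ind (S N) i - t)
      (hle : ∀ n, |∑ i ∈ Finset.range n, w (stage s i) i| ≤
        ‖∑ i ∈ Finset.range n, v (stage s i) i‖) : HasDensity {n | n ∈ S (stage s n)} t := by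
    rw [hasDensity_iff, ← tendsto_sub_nhds_zero_iff]
    refine squeeze_zero_norm' ?_ hglue
    filter_upwards [eventually_gt_atTop 0] with n hn
    have hn0' : (0 : ℝ) < n := by exact_mod_cast hn
    have e1 : (∑ i ∈ Finset.range n, {n | n ∈ S (stage s n)}.indicator (fun _ => (1 : ℝ)) i) / n - t
        = (∑ i ∈ Finset.range n, w (stage s i) i) / n := by
      simp only [hw, Finset.sum_sub_distrib, Finset.sum_const, Finset.card_range, nsmul_eq_mul]
      field_simp
      rfl
    rw [e1, norm_div, Real.norm_natCast, Real.norm_eq_abs]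
    gcongr
    exact hle n
  have hglueH : HasDensity {n | n ∈ H (stage s n)} β :=
    hback H β (fun N i => (v N i).1) (fun _ _ => rfl) fun n => by
      rw [← Prod.fst_sum]
      exact norm_fst_le (∑ i ∈ Finset.range n, v (stage s i) i)
  have hglueP : HasDensity {n | n ∈ H (stage s n) ∩ P} γ :=
    hback (fun N => H N ∩ P) γ (fun N i => (v N i).2) (fun _ _ => rfl) fun n => by
      rw [← Prod.snd_sum]
      exact norm_snd_le (∑ i ∈ Finset.range n, v (stage s i) i)
  have hZ := hasDensity_stage_boundaries hs0 hs hq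
  -- The stage is read at the right end `m`, not at `n`, so that `G` is a union of full runs `[m -
  -- stage s m, m]`. Away from the stage boundaries the two readings agree.
  set G : Set ℕ := {n | ∃ m, n ≤ m ∧ m ≤ n + stage s m ∧ m ∈ Q (stage s m)} with hG
  have hmem (n : ℕ) (hn : n ∉ ⋃ j, Set.Ico (s j - j) (s j)) : n ∈ G ↔ n ∈ H (stage s n) := by
    have hn' (j : ℕ) (h1 : n < s j) (h2 : s j ≤ n + j) : False :=
      hn (Set.mem_iUnion.2 ⟨j, by omega, h1⟩)
    have hkey (m : ℕ) (h1 : n ≤ m) (h2 : m ≤ n + stage s m ∨ m ≤ n + stage s n) :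
        stage s m = stage s n := by
      by_contra hne
      have hlt := lt_of_le_of_ne (stage_mono hmono hs0 h1) (Ne.symm hne)
      rcases h2 with h2 | h2
      · refine hn' (stage s m) ?_ (((le_stage_iff hmono hs0).1 le_rfl).trans h2)
        by_contra h
        exact absurd ((le_stage_iff hmono hs0).2 (not_lt.1 h)) (not_le.2 hlt)
      · refine hn' (stage s n + 1) ((stage_eq_iff hmono hs0).1 rfl).2 ?_
        have := (le_stage_iff hmono hs0).1 (Nat.succ_le_of_lt hlt)
        exact this.trans (by omega)
    constructor
    · rintro ⟨m, h1, h2, h3⟩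
      have h4 := hkey m h1 (Or.inl h2)
      rw [h4] at h2 h3
      exact ⟨m - n, by omega, by rwa [Nat.add_sub_cancel' h1]⟩
    · rintro ⟨j, hj, hjQ⟩
      have h4 := hkey (n + j) (by omega) (Or.inr (by omega))
      exact ⟨n + j, by omega, by omega, by rwa [h4]⟩
  have hGβ : HasDensity G β := hglueH.congr_off hZ hmem
  have hGP : HasDensity (G ∩ P) γ := hglueP.congr_off hZ fun n hn => by
    simp only [Set.mem_inter_iff, hmem n hn, Set.mem_ofPred_eq]
  refine ⟨G, ⟨?_, β, hβ0, hGβ⟩, hGβ, hGP⟩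
  refine exists_blocks (hGβ.infinite hβ0.ne') (hGβ.infinite_compl hβ1.ne) fun L => ?_
  filter_upwards [(tendsto_stage hmono hs0).eventually (eventually_ge_atTop L)] with n hn
  rintro ⟨m, h1, h2, h3⟩
  have h4 := stage_mono hmono hs0 h1
  have h5 : stage s m ≤ m := (hmono.le_apply).trans ((le_stage_iff hmono hs0).1 le_rfl)
  refine ⟨m - stage s m, m, by omega, h1, fun j hj => ⟨m, hj.2, ?_, h3⟩, by omega⟩
  have := hj.1
  omega

/-! ### Non-ergodicity produces a contraction with different frequencies. -/

/-- Approximate `B` from inside by a closed set and thicken it slightly; arbitrarily small radii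
give thickenings with null frontier. -/
theorem exists_isOpen_null_frontier_symmDiff_lt {X : Type*} [MeasurableSpace X]
    [TopologicalSpace X] [TopologicalSpace.MetrizableSpace X] [BorelSpace X] (μ : Measure X)
    [IsFiniteMeasure μ] {B : Set X} (hB : MeasurableSet B) {ε : ℝ} (hε : 0 < ε) :
    ∃ U : Set X, IsOpen U ∧ μ (frontier U) = 0 ∧ μ.real (symmDiff U B) < ε := by
  let _ := TopologicalSpace.metrizableSpaceMetric X
  obtain ⟨F, hFB, hF, hFε⟩ := hB.exists_isClosed_sdiff_lt (measure_ne_top μ B)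
    (ENNReal.ofReal_pos.2 (half_pos hε)).ne'
  obtain ⟨r, hr0, hr⟩ := exists_null_frontiers_thickening μ F
  have hlim := tendsto_measure_thickening_of_isClosed (μ := μ) (s := F)
    ⟨1, one_pos, measure_ne_top _ _⟩ hF
  have hlim' := hlim.comp (tendsto_nhdsWithin_iff.2 ⟨hr0, Eventually.of_forall fun n => (hr n).1⟩)
  obtain ⟨n, hn⟩ := (hlim'.eventually (gt_mem_nhds (ENNReal.lt_add_right (measure_ne_top μ F)
    (ENNReal.ofReal_pos.2 (half_pos hε)).ne'))).exists
  have hsub : F ⊆ Metric.thickening (r n) F := Metric.self_subset_thickening (hr n).1 F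
  refine ⟨Metric.thickening (r n) F, Metric.isOpen_thickening, (hr n).2, ?_⟩
  have h1 : μ (Metric.thickening (r n) F \ F) < ENNReal.ofReal (ε / 2) :=
    measure_sdiff_lt_of_lt_add hF.nullMeasurableSet hsub (measure_ne_top _ _) hn
  have h2 : symmDiff (Metric.thickening (r n) F) B ⊆
      (Metric.thickening (r n) F \ F) ∪ (B \ F) := by
    rintro y (⟨hy, hyB⟩ | ⟨hy, hyU⟩)
    · exact Or.inl ⟨hy, fun h => hyB (hFB h)⟩
    · exact Or.inr ⟨hy, fun h => hyU (hsub h)⟩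
  have h3 : μ (symmDiff (Metric.thickening (r n) F) B) < ENNReal.ofReal ε := by
    refine (measure_mono h2).trans_lt ((measure_union_le _ _).trans_lt ?_)
    refine (ENNReal.add_lt_add h1 hFε).trans_eq ?_
    rw [← ENNReal.ofReal_add (half_pos hε).le (half_pos hε).le, add_halves]
  exact (ENNReal.lt_ofReal_iff_toReal_lt (measure_ne_top _ _)).1 h3

theorem shiftedPath_eq_iterate (j : ℕ) : (fun y => shiftedPath y j) = pathShift^[j] := by
  induction j with
  | zero => ext y n; simp [shiftedPath]
  | succ j ih =>
    rw [Function.iterate_succ, ← ih]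
    ext y n
    simp only [shiftedPath, pathShift, Function.comp_apply]
    congr 1
    omega

theorem shiftedPath_shiftedPath (x : ℕ → ℝ) (n j : ℕ) :
    shiftedPath (shiftedPath x n) j = shiftedPath x (n + j) := by
  ext i
  simp only [shiftedPath, add_assoc]

theorem continuous_shiftedPath (j : ℕ) : Continuous fun y => shiftedPath y j := by
  rw [shiftedPath_eq_iterate]
  exact continuous_pathShift.iterate j

theorem Induces.hasDensity {x : ℕ → ℝ} {μ : ProbabilityMeasure (ℕ → ℝ)} (h : Induces x μ)
    {S : Set (ℕ → ℝ)} (hS : MeasurableSet S) (hf : (μ : Measure (ℕ → ℝ)) (frontier S) = 0) :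
    HasDensity {n | shiftedPath x n ∈ S} ((μ : Measure (ℕ → ℝ)).real S) :=
  (hasDensity_iff_averageDirac _ hS _).2 (tendsto_averageDirac_real ((induces_iff x μ).1 h) hf)

/-- An invariant set is approximated by unions of `N + 1` consecutive shifts of open sets with null
frontier. -/
theorem MeasureTheory.MeasurePreserving.exists_approx_invariant {m : Measure (ℕ → ℝ)}
    [IsFiniteMeasure m] (hinv : MeasurePreserving pathShift m m) {B : Set (ℕ → ℝ)}
    (hB : MeasurableSet B) (hBinv : pathShift ⁻¹' B = B) :
    ∃ U : ℕ → Set (ℕ → ℝ), (∀ N, IsOpen {y | ∃ j ≤ N, shiftedPath y j ∈ U N}) ∧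
      (∀ N, m (frontier {y | ∃ j ≤ N, shiftedPath y j ∈ U N}) = 0) ∧
      Tendsto (fun N => m.real (symmDiff {y | ∃ j ≤ N, shiftedPath y j ∈ U N} B)) atTop (𝓝 0) := by
  have hBj (j : ℕ) (y : ℕ → ℝ) : shiftedPath y j ∈ B ↔ y ∈ B := by
    have : (fun y => shiftedPath y j) ⁻¹' B = B := by
      rw [shiftedPath_eq_iterate]
      exact Function.IsFixedPt.preimage_iterate hBinv j
    exact Set.ext_iff.1 this y
  have hmp (j : ℕ) : MeasurePreserving (fun y => shiftedPath y j) m m := by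
    rw [shiftedPath_eq_iterate]
    exact hinv.iterate j
  -- Each of the `N + 1` shifts contributes an error below `1 / (N + 1) ^ 2`, so the union is within
  -- `1 / (N + 1)` of `B`.
  choose U hUo hUf hUB using fun N : ℕ => exists_isOpen_null_frontier_symmDiff_lt m hB
    (show 0 < (1 : ℝ) / ((N : ℝ) + 1) ^ 2 by positivity)
  have hV (N : ℕ) : {y | ∃ j ≤ N, shiftedPath y j ∈ U N} =
      ⋃ j ∈ Finset.range (N + 1), (fun y => shiftedPath y j) ⁻¹' U N := by
    ext y
    simp
  have hVo (N : ℕ) : IsOpen {y | ∃ j ≤ N, shiftedPath y j ∈ U N} := by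
    rw [hV]
    exact isOpen_biUnion fun j _ => (hUo N).preimage (continuous_shiftedPath j)
  refine ⟨U, hVo, fun N => ?_, ?_⟩
  · refine measure_mono_null (t := ⋃ j, (fun y => shiftedPath y j) ⁻¹' frontier (U N)) ?_
      (measure_iUnion_null fun j => ?_)
    · rw [(hVo N).frontier_eq, hV, Finset.closure_biUnion]
      rintro y ⟨hy, hy'⟩
      simp only [Set.mem_iUnion] at hy hy'
      obtain ⟨j, hj, hyj⟩ := hy
      refine Set.mem_iUnion.2 ⟨j, (continuous_shiftedPath j).frontier_preimage_subset _ ?_⟩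
      exact ⟨hyj, fun h => hy' ⟨j, hj, interior_subset h⟩⟩
    · rw [(hmp j).measure_preimage isClosed_frontier.measurableSet.nullMeasurableSet, hUf]
  · refine squeeze_zero (fun N => measureReal_nonneg) (fun N => ?_)
      tendsto_one_div_add_atTop_nhds_zero_nat
    have hsub : symmDiff {y | ∃ j ≤ N, shiftedPath y j ∈ U N} B ⊆
        ⋃ j ∈ Finset.range (N + 1), (fun y => shiftedPath y j) ⁻¹' symmDiff (U N) B := by
      rintro y (⟨⟨j, hj, hyU⟩, hyB⟩ | ⟨hyB, hyV⟩)
      · simp only [Set.mem_iUnion]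
        exact ⟨j, Finset.mem_range.2 (by omega), Or.inl ⟨hyU, fun hb => hyB ((hBj j y).1 hb)⟩⟩
      · simp only [Set.mem_iUnion]
        exact ⟨0, by simp, Or.inr ⟨(hBj 0 y).2 hyB, fun hu => hyV ⟨0, Nat.zero_le _, hu⟩⟩⟩
    refine (measureReal_mono hsub (measure_ne_top _ _)).trans
      ((measureReal_biUnion_finset_le _ _).trans ?_)
    refine (Finset.sum_le_card_nsmul _ _ (1 / ((N : ℝ) + 1) ^ 2) fun j _ => ?_).trans_eq ?_
    · rw [(hmp j).measureReal_preimage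
        (((hUo N).measurableSet.symmDiff hB).nullMeasurableSet)]
      exact (hUB N).le
    · rw [Finset.card_range, nsmul_eq_mul]
      push_cast
      field_simp

theorem tendsto_measureReal_inter_of_symmDiff {X : Type*} [MeasurableSpace X] {m : Measure X}
    [IsFiniteMeasure m] {V : ℕ → Set X} {B W : Set X} (hV : ∀ N, MeasurableSet (V N))
    (hB : MeasurableSet B) (hW : MeasurableSet W)
    (h : Tendsto (fun N => m.real (symmDiff (V N) B)) atTop (𝓝 0)) :
    Tendsto (fun N => m.real (V N ∩ W)) atTop (𝓝 (m.real (B ∩ W))) := by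
  rw [← tendsto_sub_nhds_zero_iff]
  refine squeeze_zero_norm (fun N => ?_) h
  refine (abs_measureReal_sub_le_measureReal_symmDiff ((hV N).inter hW).nullMeasurableSet
    (hB.inter hW).nullMeasurableSet).trans (measureReal_mono ?_ (measure_ne_top _ _))
  rintro y (⟨⟨h1, h2⟩, h3⟩ | ⟨⟨h1, h2⟩, h3⟩)
  · exact Or.inl ⟨h1, fun hb => h3 ⟨hb, h2⟩⟩
  · exact Or.inr ⟨h1, fun hb => h3 ⟨hb, h2⟩⟩

/-- An invariant set of measure strictly between `0` and `1` is the source of a contraction along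
which the frequency of any given continuity set `W` is the conditional probability of `W`. -/
theorem Induces.exists_conditional_contraction {x : ℕ → ℝ} {μ : ProbabilityMeasure (ℕ → ℝ)}
    (hμ : Induces x μ) {B W : Set (ℕ → ℝ)} (hB : MeasurableSet B) (hBinv : pathShift ⁻¹' B = B)
    (hW : MeasurableSet W) (hWf : (μ : Measure (ℕ → ℝ)) (frontier W) = 0)
    (hB0 : 0 < (μ : Measure (ℕ → ℝ)).real B) (hB1 : (μ : Measure (ℕ → ℝ)).real B < 1) :
    ∃ G : Set ℕ, IsIndexContraction G ∧
      HasDensity {i | shiftedPath x (Nat.nth (· ∈ G) i) ∈ W}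
        ((μ : Measure (ℕ → ℝ)).real (B ∩ W) / (μ : Measure (ℕ → ℝ)).real B) := by
  obtain ⟨U, hVo, hVf, hVB⟩ := hμ.measurePreserving.exists_approx_invariant hB hBinv
  have hH (N : ℕ) : {n | ∃ j ≤ N, n + j ∈ {n | shiftedPath x n ∈ U N}} =
      {n | shiftedPath x n ∈ {y | ∃ j ≤ N, shiftedPath y j ∈ U N}} := by
    ext n
    simp only [Set.mem_ofPred_eq, shiftedPath_shiftedPath]
  have hd := tendsto_measureReal_inter_of_symmDiff (fun N => (hVo N).measurableSet) hB
    MeasurableSet.univ hVB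
  simp only [Set.inter_univ] at hd
  have he := tendsto_measureReal_inter_of_symmDiff (fun N => (hVo N).measurableSet) hB hW hVB
  have hd' (N : ℕ) : HasDensity {n | ∃ j ≤ N, n + j ∈ {n | shiftedPath x n ∈ U N}}
      ((μ : Measure (ℕ → ℝ)).real {y | ∃ j ≤ N, shiftedPath y j ∈ U N}) := by
    rw [hH]
    exact hμ.hasDensity (hVo N).measurableSet (hVf N)
  have he' (N : ℕ) : HasDensity ({n | ∃ j ≤ N, n + j ∈ {n | shiftedPath x n ∈ U N}} ∩
      {n | shiftedPath x n ∈ W})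
      ((μ : Measure (ℕ → ℝ)).real ({y | ∃ j ≤ N, shiftedPath y j ∈ U N} ∩ W)) := by
    rw [hH, ← Set.ofPred_and]
    exact hμ.hasDensity (S := {y | ∃ j ≤ N, shiftedPath y j ∈ U N} ∩ W)
      ((hVo N).measurableSet.inter hW)
      (measure_mono_null (frontier_inter_subset _ _) (measure_union_null
        (measure_mono_null Set.inter_subset_left (hVf N))
        (measure_mono_null Set.inter_subset_right hWf)))
  obtain ⟨G, hG, hGβ, hGγ⟩ := exists_isIndexContraction
    (fun N => {n | shiftedPath x n ∈ U N}) {n | shiftedPath x n ∈ W} hd' he' hd he hB0 hB1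
  have hGW := HasDensity.comp_nth hG.infinite hB0 hGβ hGγ
  simp only [Set.mem_ofPred_eq] at hGW
  exact ⟨G, hG, hGW⟩

theorem Induces.ergodic {x : ℕ → ℝ} {μ : ProbabilityMeasure (ℕ → ℝ)} (hμ : Induces x μ)
    (h : ∀ x', IsContraction x' x → Induces x' μ) :
    Ergodic pathShift (μ : Measure (ℕ → ℝ)) := by
  refine ⟨hμ.measurePreserving, ⟨fun B hB hBinv => ?_⟩⟩
  by_contra hconst
  rw [Filter.eventuallyConst_set'] at hconst
  push Not at hconst
  obtain ⟨hne0, hne1⟩ := hconst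
  have hβ0 : 0 < (μ : Measure (ℕ → ℝ)).real B := by
    refine lt_of_le_of_ne measureReal_nonneg fun h0 => hne0 ?_
    exact ae_eq_empty.2 ((measureReal_eq_zero_iff).1 h0.symm)
  have hβ1 : (μ : Measure (ℕ → ℝ)).real B < 1 := by
    refine lt_of_le_of_ne measureReal_le_one fun h1 => hne1 ?_
    refine ae_eq_univ.2 ((measureReal_eq_zero_iff).1 ?_)
    rw [probReal_compl_eq_one_sub hB, h1, sub_self]
  -- With tolerance `δ`, equal frequencies give `β - δ < μ (B ∩ W) = μ W * β ≤ (β + δ) * β`, so `β *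
  -- (1 - β) < 2 * δ`; a quarter of `β * (1 - β)` contradicts this.
  obtain ⟨W, hWo, hWf, hWB⟩ := exists_isOpen_null_frontier_symmDiff_lt
    (μ : Measure (ℕ → ℝ)) hB (show 0 < (μ : Measure (ℕ → ℝ)).real B *
      (1 - (μ : Measure (ℕ → ℝ)).real B) / 4 by have := sub_pos.2 hβ1; positivity)
  obtain ⟨G, hG, hGW⟩ :=
    hμ.exists_conditional_contraction hB hBinv hWo.measurableSet hWf hβ0 hβ1
  have h1 := (induces_contraction_iff hG x μ).1 (h _ ⟨G, hG, rfl⟩)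
  have h2 := (hasDensity_iff_averageDirac _ hWo.measurableSet _).2
    (tendsto_averageDirac_real h1 hWf)
  have h3 := h2.unique hGW
  rw [eq_div_iff hβ0.ne'] at h3
  have h4 := (abs_measureReal_sub_le_measureReal_symmDiff (μ := (μ : Measure (ℕ → ℝ)))
    hWo.measurableSet.nullMeasurableSet hB.nullMeasurableSet).trans_lt hWB
  have h5 : (μ : Measure (ℕ → ℝ)).real B ≤ (μ : Measure (ℕ → ℝ)).real (B ∩ W) +
      (μ : Measure (ℕ → ℝ)).real (symmDiff W B) := by
    refine (measureReal_mono ?_ (measure_ne_top _ _)).trans (measureReal_union_le _ _)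
    intro y hy
    by_cases hw : y ∈ W
    · exact Or.inl ⟨hy, hw⟩
    · exact Or.inr (Or.inr ⟨hy, hw⟩)
  generalize (μ : Measure (ℕ → ℝ)).real B = β at *
  generalize (μ : Measure (ℕ → ℝ)).real W = w at *
  generalize (μ : Measure (ℕ → ℝ)).real (B ∩ W) = γ at *
  have h6 := (abs_lt.1 h4).2
  have h7 := mul_pos hβ0 (sub_pos.2 hβ1)
  have h8 : w * β ≤ (β + β * (1 - β) / 4) * β := by gcongr; linarith
  have h9 : β * (1 - β) / 4 * β ≤ β * (1 - β) / 4 := mul_le_of_le_one_right (by linarith) hβ1.le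
  linarith

/-! ### The theorem. -/

theorem Induces.unique {x : ℕ → ℝ} {μ ν : ProbabilityMeasure (ℕ → ℝ)} (hμ : Induces x μ)
    (hν : Induces x ν) : μ = ν :=
  tendsto_nhds_unique ((induces_iff x μ).1 hμ) ((induces_iff x ν).1 hν)

theorem mainTheorem2 (x : ℕ → ℝ) (hx : x ∈ pathsA1) :
    (x ∈ pathsA ↔ ∀ x' : ℕ → ℝ, IsContraction x' x → InduceSameProcess x' x) ∧
    ((∀ x' : ℕ → ℝ, IsContraction x' x → SameFrequencies x' x) → x ∈ pathsA) ∧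
    (HasExactLaw x → x ∈ pathsA → ∀ x' : ℕ → ℝ, IsContraction x' x → SameFrequencies x' x) := by
  refine ⟨⟨?_, fun h => ?_⟩, fun h => ?_, ?_⟩
  · rintro ⟨-, μ, hμ, herg⟩ x' hx'
    exact ⟨μ, hμ.contraction hx.2 herg hx', hμ⟩
  · obtain ⟨μ, hμ⟩ := exists_induces hx
    refine ⟨hx, μ, hμ, hμ.ergodic fun x' hx' => ?_⟩
    obtain ⟨ν, hν', hν⟩ := h x' hx'
    rwa [hμ.unique hν]
  · obtain ⟨μ, hμ⟩ := exists_induces hx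
    exact ⟨hx, μ, hμ, hμ.ergodic fun x' hx' => (h x' hx').induces hμ⟩
  · rintro ⟨ν, hν⟩ ⟨-, μ, hμ, herg⟩ x' hx' k I hI
    -- Exact frequencies on all boxes imply convergence on continuity boxes, so the exact law is the
    -- induced, ergodic one.
    have hνμ : ν = μ := (induces_of_hasDensity fun k I hI _ => hν k I hI).unique hμ
    subst hνμ
    exact ⟨_, hμ.hasDensity_hitSet_contraction hx.2 herg hx' hI (hν k I hI), hν k I hI⟩
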